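/- Let $\mathcal M$ be a smooth oriented Riemannian $3$-manifold with metric $\langle\cdot,\cdot\rangle$ and Levi-Civita connection $\overline\nabla$, let $\mathbb M^2$ be a smooth Riemannian surface with Gauss curvature $\kappa$, and let $\pi:\mathcal M\to\mathbb M^2$ be a Killing submersion: a (surjective) Riemannian submersion whose fibers are the trajectories of a unit Killing vector field $\xi$ on $\mathcal M$. For $u,v\in T_p\mathcal M$ let $u\wedge v\in T_p\mathcal M$ denote the cross product, defined by $\langle u\wedge v,w\rangle=\det(u,v,w)$ for all $w\in T_p\mathcal M$, where $\det$ is the oriented Riemannian volume form. A tangent vector is horizontal if it is orthogonal to the fiber of $\pi$ through its base point. Let $\bar K(u,v)$ denote the sectional curvature of the plane spanned by linearly independent $u,v\in T_p\mathcal M$. Then: (1) There exists a function $\tau:\mathcal M\to\mathbb R$ such that $$\overline\nabla_u\,\xi=\tau(p)\,u\wedge\xi_p\qquad\text{for all } p\in\mathcal M,\ u\in T_p\mathcal M .$$ (2) For every function $\tau$ as in (1) and every $p\in\mathcal M$: - if $u,v\in T_p\mathcal M$ are horizontal and linearly independent (in particular, if they are orthonormal and $\{u,v,\xi_p\}$ is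 positively oriented), then $\bar K(u,v)=\kappa(\pi(p))-3\,\tau(p)^2$; - if $u\in T_p\mathcal M$ and $\xi_p$ are linearly independent (in particular, if $u$ is a horizontal unit vector), then $\bar K(u,\xi_p)=\tau(p)^2$. -/

import Mathlib

open Bundle FiberBundle VectorField
open scoped Manifold ContDiff Topology

noncomputable section

namespace KillingSubmersion

section Connection

variable {E : Type*} [NormedAddCommGroup E] [NormedSpace ℝ E] [FiniteDimensional ℝ E]
  {H : Type*} [TopologicalSpace H] (I : ModelWithCorners ℝ E H)
  {M : Type*} [TopologicalSpace M] [ChartedSpace H M] [IsManifold I ∞ M]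
  [RiemannianBundle (fun x : M ↦ TangentSpace I x)]
  [IsContMDiffRiemannianBundle I ∞ E (fun x : M ↦ TangentSpace I x)]

/-- The right-hand side of Koszul's formula for `⟨∇_X Y, Z⟩` at the point `x`. -/
def koszul (X Y Z : Π x : M, TangentSpace I x) (x : M) : ℝ :=
  (1 / 2 : ℝ) *
    (mvfderiv I (fun y : M ↦ inner ℝ (Y y) (Z y)) x (X x)
      + mvfderiv I (fun y : M ↦ inner ℝ (X y) (Z y)) x (Y x)
      - mvfderiv I (fun y : M ↦ inner ℝ (X y) (Y y)) x (Z x)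
      + inner ℝ (mlieBracket I X Y x) (Z x)
      - inner ℝ (mlieBracket I X Z x) (Y x)
      - inner ℝ (mlieBracket I Y Z x) (X x))

variable {I}

theorem mdifferentiableAt_inner {X Y : Π x : M, TangentSpace I x} {x : M}
    (hX : MDiffAt (T% X) x) (hY : MDiffAt (T% Y) x) :
    MDiffAt (fun y : M ↦ inner ℝ (X y) (Y y)) x :=
  MDifferentiableAt.inner_bundle (IB := I) (F := E) (E := fun x : M ↦ TangentSpace I x)
    (b := fun y ↦ y) hX hY

theorem koszul_tensorial_left {Y Z : Π x : M, TangentSpace I x} {x : M}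
    (hY : MDiffAt (T% Y) x) (hZ : MDiffAt (T% Z) x) :
    TensorialAt I E (fun X ↦ koszul I X Y Z x) x where
  smul {f X} hf hX := by
    simp only [koszul, Pi.smul_apply', inner_smul_left, inner_smul_right]
    simp [mvfderiv_fun_mul hf (mdifferentiableAt_inner hX hZ), mvfderiv_fun_mul hf (mdifferentiableAt_inner hX hY),
      mlieBracket_smul_left hf hX, inner_add_left, inner_smul_left]
    ring
  add {X X'} hX hX' := by
    simp only [koszul, Pi.add_apply, inner_add_left, inner_add_right]
    simp [mvfderiv_fun_add (mdifferentiableAt_inner hX hZ) (mdifferentiableAt_inner hX' hZ),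
      mvfderiv_fun_add (mdifferentiableAt_inner hX hY) (mdifferentiableAt_inner hX' hY),
      mlieBracket_add_left hX hX', inner_add_left]
    ring

theorem koszul_tensorial_right {X Y : Π x : M, TangentSpace I x} {x : M}
    (hX : MDiffAt (T% X) x) (hY : MDiffAt (T% Y) x) :
    TensorialAt I E (fun Z ↦ koszul I X Y Z x) x where
  smul {f Z} hf hZ := by
    simp only [koszul, Pi.smul_apply', inner_smul_right]
    simp [mvfderiv_fun_mul hf (mdifferentiableAt_inner hX hZ),
      mvfderiv_fun_mul hf (mdifferentiableAt_inner hY hZ), mlieBracket_smul_right hf hZ, inner_add_left, inner_smul_left, real_inner_comm]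
    ring
  add {Z Z'} hZ hZ' := by
    simp only [koszul, Pi.add_apply, inner_add_right]
    simp [mvfderiv_fun_add (mdifferentiableAt_inner hX hZ) (mdifferentiableAt_inner hX hZ'),
      mvfderiv_fun_add (mdifferentiableAt_inner hY hZ) (mdifferentiableAt_inner hY hZ'),
      mlieBracket_add_right hZ hZ', inner_add_left]
    ring

theorem koszul_add_mid {X Y Y' Z : Π x : M, TangentSpace I x} {x : M}
    (hX : MDiffAt (T% X) x) (hY : MDiffAt (T% Y) x) (hY' : MDiffAt (T% Y') x)
    (hZ : MDiffAt (T% Z) x) :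
    koszul I X (Y + Y') Z x = koszul I X Y Z x + koszul I X Y' Z x := by
  simp only [koszul, Pi.add_apply, inner_add_left, inner_add_right]
  simp [mvfderiv_fun_add (mdifferentiableAt_inner hX hY) (mdifferentiableAt_inner hX hY'),
    mvfderiv_fun_add (mdifferentiableAt_inner hY hZ) (mdifferentiableAt_inner hY' hZ),
    mlieBracket_add_right hY hY', mlieBracket_add_left hY hY', inner_add_left]
  ring

theorem koszul_smul_mid {X Y Z : Π x : M, TangentSpace I x} {f : M → ℝ} {x : M}
    (hX : MDiffAt (T% X) x) (hY : MDiffAt (T% Y) x) (hZ : MDiffAt (T% Z) x)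
    (hf : MDiffAt f x) :
    koszul I X (f • Y) Z x =
      f x * koszul I X Y Z x + mvfderiv I f x (X x) * inner ℝ (Y x) (Z x) := by
  simp only [koszul, Pi.smul_apply', inner_smul_left, inner_smul_right]
  simp [mvfderiv_fun_mul hf (mdifferentiableAt_inner hX hY), mvfderiv_fun_mul hf (mdifferentiableAt_inner hY hZ),
    mlieBracket_smul_right hf hY, mlieBracket_smul_left hf hY, inner_add_left, inner_smul_left,
    real_inner_comm]
  ring

instance (x : M) : FiniteDimensional ℝ (TangentSpace I x) :=
  inferInstanceAs (FiniteDimensional ℝ E)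

instance (x : M) : CompleteSpace (TangentSpace I x) := FiniteDimensional.complete ℝ _

open Classical in
/-- `∇ Y` at `x`, as the endomorphism `u ↦ ∇_u Y` of the tangent space, given by Koszul's formula
`⟨∇_u Y, w⟩ = koszul X Y Z x` for any differentiable `X`, `Z` with `X x = u`, `Z x = w`
(and `0` if `Y` is not differentiable at `x`). -/
def leviCivitaFun (Y : Π x : M, TangentSpace I x) (x : M) :
    TangentSpace I x →L[ℝ] TangentSpace I x :=
  if hY : MDiffAt (T% Y) x then
    LinearMap.toContinuousLinearMap
      { toFun := fun u ↦ (InnerProductSpace.toDual ℝ (TangentSpace I x)).symm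
          (TensorialAt.mkHom₂ (fun X Z ↦ koszul I X Y Z x) x
            (fun _ hZ ↦ koszul_tensorial_left hY hZ)
            (fun _ hX ↦ koszul_tensorial_right hX hY) u)
        map_add' := fun u v ↦ by simp
        map_smul' := fun c u ↦ by simp }
  else 0

theorem inner_leviCivitaFun {X Y Z : Π x : M, TangentSpace I x} {x : M}
    (hX : MDiffAt (T% X) x) (hY : MDiffAt (T% Y) x) (hZ : MDiffAt (T% Z) x) :
    inner ℝ (leviCivitaFun Y x (X x)) (Z x) = koszul I X Y Z x := by
  simp only [leviCivitaFun, hY, dite_true]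
  simp [TensorialAt.mkHom₂_apply _ _ hX hZ]

theorem leviCivitaFun_isCovariantDerivativeOn :
    IsCovariantDerivativeOn E
      (leviCivitaFun : (Π x : M, TangentSpace I x) →
        Π x : M, TangentSpace I x →L[ℝ] TangentSpace I x) Set.univ where
  add {Y Y' x} hY hY' _ := by
    ext u
    refine ext_inner_right ℝ fun w ↦ ?_
    have hu := mdifferentiableAt_extend I E (V := (TangentSpace I : M → Type _)) u
    have hw := mdifferentiableAt_extend I E (V := (TangentSpace I : M → Type _)) w
    have h := inner_leviCivitaFun hu (mdifferentiableAt_add_section hY hY') hw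
    have h₁ := inner_leviCivitaFun hu hY hw
    have h₂ := inner_leviCivitaFun hu hY' hw
    rw [koszul_add_mid hu hY hY' hw, ← h₁, ← h₂] at h
    simpa [inner_add_left] using h
  leibniz {Y f x} hY hf _ := by
    ext u
    refine ext_inner_right ℝ fun w ↦ ?_
    have hu := mdifferentiableAt_extend I E (V := (TangentSpace I : M → Type _)) u
    have hw := mdifferentiableAt_extend I E (V := (TangentSpace I : M → Type _)) w
    have h := inner_leviCivitaFun hu (hf.smul_section hY) hw
    have h₁ := inner_leviCivitaFun hu hY hw
    rw [koszul_smul_mid hu hY hw hf, ← h₁] at h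
    simpa [inner_add_left, inner_smul_left] using h

variable (I) in
/-- The Levi-Civita connection; `leviCivita I Y x u` is `∇_u Y`. -/
def leviCivita : CovariantDerivative I E (TangentSpace I : M → Type _) where
  toFun := leviCivitaFun
  isCovariantDerivativeOnUniv := leviCivitaFun_isCovariantDerivativeOn

theorem leviCivita_torsion : (leviCivita I (M := M)).torsion = 0 := by
  rw [CovariantDerivative.torsion_eq_zero_iff]
  intro X Y x hX hY
  refine ext_inner_right ℝ fun w ↦ ?_
  have hw := mdifferentiableAt_extend I E (V := (TangentSpace I : M → Type _)) w
  have h₁ := inner_leviCivitaFun hX hY hw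
  have h₂ := inner_leviCivitaFun hY hX hw
  rw [extend_apply_self] at h₁ h₂
  rw [inner_sub_left]
  change inner ℝ (leviCivitaFun Y x (X x)) w - inner ℝ (leviCivitaFun X x (Y x)) w = _
  rw [h₁, h₂, koszul, koszul, mlieBracket_swap_apply (V := Y) (W := X)]
  simp only [real_inner_comm, inner_neg_left, extend_apply_self]
  ring

theorem leviCivita_metric {X Y Z : Π x : M, TangentSpace I x} {x : M}
    (hX : MDiffAt (T% X) x) (hY : MDiffAt (T% Y) x) (hZ : MDiffAt (T% Z) x) :
    mvfderiv I (fun y : M ↦ inner ℝ (Y y) (Z y)) x (X x) =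
      inner ℝ (leviCivita I Y x (X x)) (Z x) + inner ℝ (Y x) (leviCivita I Z x (X x)) := by
  have h₁ := inner_leviCivitaFun hX hY hZ
  have h₂ := inner_leviCivitaFun hX hZ hY
  change _ = inner ℝ (leviCivitaFun Y x (X x)) (Z x) + inner ℝ (Y x) (leviCivitaFun Z x (X x))
  rw [real_inner_comm (leviCivitaFun Z x (X x)) (Y x), h₁, h₂, koszul, koszul,
    mlieBracket_swap_apply (V := Z) (W := Y)]
  simp only [real_inner_comm, inner_neg_left]
  ring

variable (I) in
/-- `R(X, Y)Z = ∇_X ∇_Y Z - ∇_Y ∇_X Z - ∇_[X,Y] Z` for vector fields. -/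
def curvatureField (X Y Z : Π x : M, TangentSpace I x) (x : M) : TangentSpace I x :=
  leviCivita I (fun y ↦ leviCivita I Z y (Y y)) x (X x)
    - leviCivita I (fun y ↦ leviCivita I Z y (X y)) x (Y x)
    - leviCivita I Z x (mlieBracket I X Y x)

variable (I) in
/-- The Riemann curvature tensor `R(u, v)w` at `x`, evaluated through extensions of the tangent
vectors to vector fields that are smooth near `x`; by tensoriality the choice is immaterial. -/
def curvature (x : M) (u v w : TangentSpace I x) : TangentSpace I x :=
  curvatureField I (extend E u) (extend E v) (extend E w) x

variable (I) in
/-- The sectional curvature of the plane of `T_x M` spanned by the linearly independent vectors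
`u` and `v`. -/
def sectionalCurvature (x : M) (u v : TangentSpace I x) : ℝ :=
  inner ℝ (curvature I x u v v) u / (‖u‖ ^ 2 * ‖v‖ ^ 2 - inner ℝ u v ^ 2)

variable (I) in
/-- `ξ` is a Killing field: it is smooth and the Lie derivative of the metric along `ξ` vanishes,
that is, `ξ⟨X, Y⟩ = ⟨[ξ, X], Y⟩ + ⟨X, [ξ, Y]⟩`. -/
structure IsKilling (ξ : Π x : M, TangentSpace I x) : Prop where
  smooth : CMDiff ∞ (T% ξ)
  lie_metric : ∀ (x : M) (X Y : Π x : M, TangentSpace I x),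
    MDiffAt (T% X) x → MDiffAt (T% Y) x →
      mvfderiv I (fun y : M ↦ inner ℝ (X y) (Y y)) x (ξ x) =
        inner ℝ (mlieBracket I ξ X x) (Y x) + inner ℝ (X x) (mlieBracket I ξ Y x)

variable (I) in
/-- The trajectory of `ξ` through `p`: all points reached from `p` along integral curves of `ξ`
defined on open intervals containing `0`. -/
def trajectory (ξ : Π x : M, TangentSpace I x) (p : M) : Set M :=
  {q | ∃ (γ : ℝ → M) (s : Set ℝ), IsOpen s ∧ s.OrdConnected ∧ (0 : ℝ) ∈ s ∧
    IsMIntegralCurveOn (I := I) γ ξ s ∧ γ 0 = p ∧ q ∈ γ '' s}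

end Connection

section Surface

variable {B : Type*} [TopologicalSpace B] [ChartedSpace (EuclideanSpace ℝ (Fin 2)) B]
  [IsManifold (𝓡 2) ∞ B] [RiemannianBundle (fun b : B ↦ TangentSpace (𝓡 2) b)]
  [IsContMDiffRiemannianBundle (𝓡 2) ∞ (EuclideanSpace ℝ (Fin 2))
    (fun b : B ↦ TangentSpace (𝓡 2) b)]

/-- The Gauss curvature of a surface: the sectional curvature of the tangent plane, computed in
the basis of coordinate vectors (the choice of the basis is immaterial). -/
def gaussCurvature (b : B) : ℝ :=
  sectionalCurvature (𝓡 2) b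
    (EuclideanSpace.single 0 1 : EuclideanSpace ℝ (Fin 2))
    (EuclideanSpace.single 1 1 : EuclideanSpace ℝ (Fin 2))

end Surface

section Orientation

variable {M : Type*} [TopologicalSpace M] [ChartedSpace (EuclideanSpace ℝ (Fin 3)) M]

instance (x : M) : Fact (Module.finrank ℝ (TangentSpace (𝓡 3) x) = 3) :=
  ⟨(finrank_euclideanSpace_fin : Module.finrank ℝ (EuclideanSpace ℝ (Fin 3)) = 3)⟩

variable [IsManifold (𝓡 3) ∞ M] [RiemannianBundle (fun x : M ↦ TangentSpace (𝓡 3) x)]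

variable (M) in
/-- An orientation of a Riemannian `3`-manifold: an orientation of every tangent space such that
a smooth local frame that is positive at a point stays positive nearby. -/
structure ManifoldOrientation where
  orient : Π x : M, Orientation ℝ (TangentSpace (𝓡 3) x) (Fin 3)
  locally_pos : ∀ (x₀ : M) (X : Fin 3 → Π x : M, TangentSpace (𝓡 3) x),
    (∀ i, ContMDiffAt (𝓡 3) (𝓡 3).tangent ∞
      (fun x ↦ (⟨x, X i x⟩ : TangentBundle (𝓡 3) M)) x₀) →
    0 < (orient x₀).volumeForm (fun i ↦ X i x₀) →
    ∀ᶠ x in 𝓝 x₀, 0 < (orient x).volumeForm (fun i ↦ X i x)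

/-- The cross product `u ∧ v` in the oriented Euclidean space `T_x M`, characterized by
`⟨u ∧ v, w⟩ = det(u, v, w)`. -/
def cross (o : ManifoldOrientation M) {x : M} (u v : TangentSpace (𝓡 3) x) :
    TangentSpace (𝓡 3) x :=
  (InnerProductSpace.toDual ℝ (TangentSpace (𝓡 3) x)).symm
    (LinearMap.toContinuousLinearMap
      { toFun := fun w ↦ (o.orient x).volumeForm ![u, v, w]
        map_add' := fun w w' ↦ by
          have e : ∀ z, Function.update ![u, v, 0] 2 z = ![u, v, z] := fun z ↦ by
            ext i; fin_cases i <;> rfl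
          have := (o.orient x).volumeForm.map_update_add ![u, v, 0] 2 w w'
          rwa [e, e, e] at this
        map_smul' := fun c w ↦ by
          have e : ∀ z, Function.update ![u, v, 0] 2 z = ![u, v, z] := fun z ↦ by
            ext i; fin_cases i <;> rfl
          have := (o.orient x).volumeForm.map_update_smul ![u, v, 0] 2 c w
          rwa [e, e] at this })

theorem inner_cross (o : ManifoldOrientation M) {x : M} (u v w : TangentSpace (𝓡 3) x) :
    inner ℝ (cross o u v) w = (o.orient x).volumeForm ![u, v, w] := by
  simp [cross]

end Orientation

section Submersion

variable {M : Type*} [TopologicalSpace M] [ChartedSpace (EuclideanSpace ℝ (Fin 3)) M]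
  [IsManifold (𝓡 3) ∞ M] [RiemannianBundle (fun x : M ↦ TangentSpace (𝓡 3) x)]
  {B : Type*} [TopologicalSpace B] [ChartedSpace (EuclideanSpace ℝ (Fin 2)) B]
  [IsManifold (𝓡 2) ∞ B] [RiemannianBundle (fun b : B ↦ TangentSpace (𝓡 2) b)]

/-- The tangent vector `u` at `p` is horizontal: orthogonal to the fiber of `pr` through `p`. -/
def IsHorizontal (pr : M → B) (p : M) (u : TangentSpace (𝓡 3) p) : Prop :=
  ∀ w : TangentSpace (𝓡 3) p, mfderiv (𝓡 3) (𝓡 2) pr p w = 0 → inner ℝ u w = 0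

/-- `pr` is a Riemannian submersion: smooth, onto, of maximal rank, and its differential preserves
the lengths of horizontal vectors. -/
structure IsRiemannianSubmersion (pr : M → B) : Prop where
  smooth : ContMDiff (𝓡 3) (𝓡 2) ∞ pr
  surjective : Function.Surjective pr
  mfderiv_surjective : ∀ p : M, Function.Surjective (mfderiv (𝓡 3) (𝓡 2) pr p)
  norm_mfderiv : ∀ (p : M) (u : TangentSpace (𝓡 3) p), IsHorizontal pr p u →
    ‖mfderiv (𝓡 3) (𝓡 2) pr p u‖ = ‖u‖

variable [IsContMDiffRiemannianBundle (𝓡 3) ∞ (EuclideanSpace ℝ (Fin 3))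
    (fun x : M ↦ TangentSpace (𝓡 3) x)]

/-- A Killing submersion: a Riemannian submersion of a `3`-manifold over a surface whose fibers
are the trajectories of the unit Killing field `ξ`. -/
structure IsKillingSubmersion (pr : M → B) (ξ : Π x : M, TangentSpace (𝓡 3) x) : Prop where
  submersion : IsRiemannianSubmersion pr
  killing : IsKilling (𝓡 3) ξ
  unit : ∀ p : M, ‖ξ p‖ = 1
  fiber_eq : ∀ p : M, pr ⁻¹' {pr p} = trajectory (𝓡 3) ξ p

/-- The relation `∇_X ξ = τ X ∧ ξ` for all tangent vectors `X`. -/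
def IsBundleCurvature (o : ManifoldOrientation M) (ξ : Π x : M, TangentSpace (𝓡 3) x)
    (τ : M → ℝ) : Prop :=
  ∀ (p : M) (u : TangentSpace (𝓡 3) p), leviCivita (𝓡 3) ξ p u = τ p • cross o u (ξ p)

end Submersion

end KillingSubmersion

end

/-
For horizontal fields `X`, `Y` lifted from the base, O'Neill's formula expresses the curvature
upstairs by that of the base and the vertical parts of the derivatives `∇_X Y`. When the fibers are
one-dimensional, with unit field `ξ`, that vertical part is `⟨∇_X Y, ξ⟩ ξ = -⟨∇_X ξ, Y⟩ ξ`, so the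
correction is `-3 ⟨∇_X ξ, Y⟩²`. If moreover `ξ` is Killing, then `∇ξ` is skew-symmetric and
annihilates `ξ`; in dimension three such an endomorphism is a multiple `τ` of `u ↦ u ∧ ξ`, which
turns the correction into `-3 τ²`. Finally, differentiating `⟨∇_X ξ, X⟩ = 0` along the geodesic
field `ξ` gives `⟨R(X, ξ) ξ, X⟩ = ‖∇_X ξ‖²`, hence `τ²` for the planes containing `ξ`.
-/

noncomputable section

namespace KillingSubmersion

section Calculus

variable {E : Type*} [NormedAddCommGroup E] [NormedSpace ℝ E]
  {H : Type*} [TopologicalSpace H] {I : ModelWithCorners ℝ E H}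
  {M : Type*} [TopologicalSpace M] [ChartedSpace H M]
  {E' : Type*} [NormedAddCommGroup E'] [NormedSpace ℝ E']
  {H' : Type*} [TopologicalSpace H'] {I' : ModelWithCorners ℝ E' H'}
  {M' : Type*} [TopologicalSpace M'] [ChartedSpace H' M']

theorem mvfderiv_congr {f g : M → ℝ} {x : M} (h : f =ᶠ[𝓝 x] g) :
    mvfderiv I f x = mvfderiv I g x := by
  ext u
  exact DFunLike.congr_fun (h.mfderiv_eq (I := I) (I' := 𝓘(ℝ, ℝ))) u

theorem mvfderiv_eq_zero_of_eventually_eq {f : M → ℝ} {x : M} {c : ℝ}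
    (h : ∀ᶠ y in 𝓝 x, f y = c) : mvfderiv I f x = 0 := by
  rw [mvfderiv_congr (g := fun _ ↦ c) h, mvfderiv_const]

variable [IsManifold I ∞ M]

theorem eventually_mdifferentiableAt_section {n : ℕ∞ω} {X : Π x : M, TangentSpace I x} {x : M}
    (hX : CMDiffAt n (T% X) x) (hn : n ≠ 0) : ∀ᶠ y in 𝓝 x, MDiffAt (T% X) y :=
  ((contMDiffAt_iff_contMDiffAt_nhds (by simp)).1
    (hX.of_le (ENat.one_le_iff_ne_zero_withTop.2 hn))).mono
    fun _ h ↦ h.mdifferentiableAt one_ne_zero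

theorem contMDiffAt_mlieBracket [CompleteSpace E] {m n : ℕ∞}
    {X Y : Π x : M, TangentSpace I x} {x : M} (hX : CMDiffAt n (T% X) x)
    (hY : CMDiffAt n (T% Y) x) (hmn : m + 1 ≤ n) :
    CMDiffAt m (T% (mlieBracket I X Y)) x := by
  have : IsManifold I ((n : ℕ∞ω) + 1) M :=
    IsManifold.of_le (n := ∞) (by exact_mod_cast le_top (a := n + 1))
  have : IsManifold I (minSmoothness ℝ 2) M := by
    rw [minSmoothness_of_isRCLikeNormedField]; infer_instance
  refine hX.mlieBracket_vectorField hY ?_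
  rw [minSmoothness_of_isRCLikeNormedField]
  exact_mod_cast hmn

theorem tangentVector_ext_mvfderiv {x : M} {v w : TangentSpace I x}
    (h : ∀ f : M → ℝ, CMDiffAt 2 f x → mvfderiv I f x v = mvfderiv I f x w) : v = w := by
  have hc : CMDiffAt 2 (extChartAt I x) x := contMDiffAt_extChartAt
  refine (isInvertible_mfderiv_extChartAt (mem_extChartAt_source x)).injective <|
    (SeparatingDual.eq_iff_forall_dual_eq (R := ℝ) (V := E)).2 fun ℓ ↦ ?_
  have hℓ : ContMDiff 𝓘(ℝ, E) 𝓘(ℝ, ℝ) 2 ℓ := ℓ.contMDiff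
  have key (u : TangentSpace I x) : mvfderiv I (ℓ ∘ extChartAt I x) x u =
      ℓ (mfderiv I 𝓘(ℝ, E) (extChartAt I x) x u) := by
    rw [mvfderiv_comp_apply x (hℓ.mdifferentiableAt two_ne_zero)
      (hc.mdifferentiableAt two_ne_zero)]
    simp only [mvfderiv, mfderiv_eq_fderiv, ContinuousLinearMap.fderiv]
    rfl
  simpa only [key] using h (ℓ ∘ extChartAt I x) (hℓ.contMDiffAt.comp x hc)

section

variable [IsManifold I' ∞ M']

theorem eventually_mdifferentiableAt {n : ℕ∞ω} {g : M → M'} {x : M}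
    (hg : CMDiffAt n g x) (hn : n ≠ 0) : ∀ᶠ y in 𝓝 x, MDiffAt g y :=
  ((contMDiffAt_iff_contMDiffAt_nhds (by simp)).1
    (hg.of_le (ENat.one_le_iff_ne_zero_withTop.2 hn))).mono
    fun _ h ↦ h.mdifferentiableAt one_ne_zero

theorem contMDiffAt_mfderiv_apply {m n : ℕ∞ω} {g : M → M'} {X : Π x : M, TangentSpace I x} {x : M}
    (hg : CMDiffAt n g x) (hX : CMDiffAt m (T% X) x) (hmn : m + 1 ≤ n) :
    ContMDiffAt I I'.tangent m
      (fun y ↦ (⟨g y, mfderiv I I' g y (X y)⟩ : TangentBundle I' M')) x :=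
  ContMDiffAt.clm_apply_of_inCoordinates (hg.mfderiv_const hmn) hX
    (hg.of_le (le_self_add.trans hmn))

theorem contMDiffAt_mvfderiv_apply {m n : ℕ∞ω} {f : M → ℝ} {X : Π x : M, TangentSpace I x} {x : M}
    (hf : CMDiffAt n f x) (hX : CMDiffAt m (T% X) x) (hmn : m + 1 ≤ n) :
    CMDiffAt m (fun y ↦ mvfderiv I f y (X y)) x := by
  have h := (contMDiffAt_totalSpace.1 (contMDiffAt_mfderiv_apply hf hX hmn)).2
  simp only [trivializationAt_model_space_apply] at h
  exact h

theorem mvfderiv_mvfderiv_comp {g : M → M'} {f : M' → ℝ} {X Y : Π x : M, TangentSpace I x}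
    {Y' : Π x : M', TangentSpace I' x} {x : M} (hg : CMDiffAt 2 g x) (hf : CMDiffAt 2 f (g x))
    (hY' : CMDiffAt 2 (T% Y') (g x))
    (hYY' : ∀ᶠ y in 𝓝 x, mfderiv I I' g y (Y y) = Y' (g y)) :
    mvfderiv I (fun y ↦ mvfderiv I (f ∘ g) y (Y y)) x (X x) =
      mvfderiv I' (fun y ↦ mvfderiv I' f y (Y' y)) (g x) (mfderiv I I' g x (X x)) := by
  have e : (fun y ↦ mvfderiv I (f ∘ g) y (Y y)) =ᶠ[𝓝 x]
      (fun y ↦ mvfderiv I' f y (Y' y)) ∘ g := by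
    filter_upwards [eventually_mdifferentiableAt hg two_ne_zero, hg.continuousAt.eventually
      (eventually_mdifferentiableAt hf two_ne_zero), hYY'] with y hgy hfy hYy
    rw [mvfderiv_comp_apply y hfy hgy, hYy]
    rfl
  have hfY' : MDiffAt (fun y ↦ mvfderiv I' f y (Y' y)) (g x) :=
    (contMDiffAt_mvfderiv_apply hf (hY'.of_le one_le_two) one_add_one_eq_two.le).mdifferentiableAt
      one_ne_zero
  rw [mvfderiv_congr e, mvfderiv_comp_apply x hfY' (hg.mdifferentiableAt two_ne_zero)]

end

variable [FiniteDimensional ℝ E]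

theorem mlieBracket_mlieBracket_smul {f : M → ℝ} {X Y W : Π x : M, TangentSpace I x} {x : M}
    (hf : CMDiffAt 2 f x) (hY : CMDiffAt 2 (T% Y) x) (hW : CMDiffAt 2 (T% W) x) :
    mlieBracket I X (mlieBracket I Y (f • W)) x =
      (mvfderiv I (fun y ↦ mvfderiv I f y (Y y)) x (X x) • W x
        + mvfderiv I f x (Y x) • mlieBracket I X W x)
      + (mvfderiv I f x (X x) • mlieBracket I Y W x
        + f x • mlieBracket I X (mlieBracket I Y W) x) := by
  have e : mlieBracket I Y (f • W) =ᶠ[𝓝 x]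
      (fun y ↦ mvfderiv I f y (Y y)) • W + f • mlieBracket I Y W := by
    filter_upwards [eventually_mdifferentiableAt_section hW two_ne_zero,
      eventually_mdifferentiableAt hf two_ne_zero] with y hWy hfy
    rw [mlieBracket_smul_right hfy hWy]
    rfl
  have hfx : MDiffAt f x := hf.mdifferentiableAt two_ne_zero
  have hWx : MDiffAt (T% W) x := hW.mdifferentiableAt two_ne_zero
  have hfY : MDiffAt (fun y ↦ mvfderiv I f y (Y y)) x :=
    (contMDiffAt_mvfderiv_apply hf (hY.of_le one_le_two) one_add_one_eq_two.le).mdifferentiableAt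
      one_ne_zero
  have hYW : MDiffAt (T% (mlieBracket I Y W)) x :=
    (contMDiffAt_mlieBracket (n := 2) (m := 1) hY hW one_add_one_eq_two.le).mdifferentiableAt
      one_ne_zero
  rw [Filter.EventuallyEq.mlieBracket_vectorField_eq (Filter.EventuallyEq.refl _ X) e,
    mlieBracket_add_right (hfY.smul_section hWx) (hfx.smul_section hYW),
    mlieBracket_smul_right hfY hWx, mlieBracket_smul_right hfx hYW]

theorem mvfderiv_mlieBracket {f : M → ℝ} {X Y : Π x : M, TangentSpace I x} {x : M}
    (hf : CMDiffAt 2 f x) (hX : CMDiffAt 2 (T% X) x) (hY : CMDiffAt 2 (T% Y) x) :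
    mvfderiv I f x (mlieBracket I X Y x) =
      mvfderiv I (fun y ↦ mvfderiv I f y (Y y)) x (X x)
        - mvfderiv I (fun y ↦ mvfderiv I f y (X y)) x (Y x) := by
  cases subsingleton_or_nontrivial (TangentSpace I x) with
  | inl _ => simp [Subsingleton.elim _ (0 : TangentSpace I x)]
  | inr _ =>
    obtain ⟨w, hw⟩ := exists_ne (0 : TangentSpace I x)
    have : IsManifold I (minSmoothness ℝ 3) M := by
      rw [minSmoothness_of_isRCLikeNormedField]; infer_instance
    have jacobi {W : Π x : M, TangentSpace I x} (hW : CMDiffAt 2 (T% W) x) :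
        mlieBracket I X (mlieBracket I Y W) x =
          mlieBracket I (mlieBracket I X Y) W x + mlieBracket I Y (mlieBracket I X W) x := by
      apply leibniz_identity_mlieBracket_apply <;> rwa [minSmoothness_of_isRCLikeNormedField]
    have hW : CMDiffAt 2 (T% (extend E w)) x := contMDiffAt_extend I E w
    -- The `w`-component of the Jacobi identity for `X`, `Y` and `f • W` is the claim.
    have J := jacobi (hf.smul_section hW)
    rw [mlieBracket_mlieBracket_smul hf hY hW, mlieBracket_mlieBracket_smul hf hX hW,
      mlieBracket_smul_right (hf.mdifferentiableAt two_ne_zero)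
        (hW.mdifferentiableAt two_ne_zero), jacobi hW, extend_apply_self] at J
    refine smul_left_injective ℝ hw ?_
    simp only [sub_smul]
    linear_combination (norm := module) -J

variable [IsManifold I' ∞ M'] [FiniteDimensional ℝ E']

theorem mfderiv_mlieBracket_of_related {g : M → M'} {X Y : Π x : M, TangentSpace I x}
    {X' Y' : Π x : M', TangentSpace I' x} {x : M} (hg : CMDiffAt 2 g x)
    (hX : CMDiffAt 2 (T% X) x) (hY : CMDiffAt 2 (T% Y) x)
    (hX' : CMDiffAt 2 (T% X') (g x)) (hY' : CMDiffAt 2 (T% Y') (g x))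
    (hXX' : ∀ᶠ y in 𝓝 x, mfderiv I I' g y (X y) = X' (g y))
    (hYY' : ∀ᶠ y in 𝓝 x, mfderiv I I' g y (Y y) = Y' (g y)) :
    mfderiv I I' g x (mlieBracket I X Y x) = mlieBracket I' X' Y' (g x) := by
  refine tangentVector_ext_mvfderiv fun f hf ↦ ?_
  rw [← mvfderiv_comp_apply x (hf.mdifferentiableAt two_ne_zero)
      (hg.mdifferentiableAt two_ne_zero),
    mvfderiv_mlieBracket (hf.comp x hg) hX hY, mvfderiv_mlieBracket hf hX' hY',
    mvfderiv_mvfderiv_comp hg hf hY' hYY', mvfderiv_mvfderiv_comp hg hf hX' hXX',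
    hXX'.self_of_nhds, hYY'.self_of_nhds]

end Calculus

section LeviCivita

theorem coeff_eq_det_div_det_gram {V ι : Type*} [NormedAddCommGroup V] [InnerProductSpace ℝ V]
    [Fintype ι] [DecidableEq ι] {s : ι → V} (hs : LinearIndependent ℝ s) (c : ι → ℝ) (i : ι) :
    c i = ((Matrix.gram ℝ s).updateCol i fun j ↦ inner ℝ (∑ k, c k • s k) (s j)).det
      / (Matrix.gram ℝ s).det := by
  have hgram : (fun j ↦ inner ℝ (∑ k, c k • s k) (s j)) = (Matrix.gram ℝ s).mulVec c := by
    ext j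
    simp only [sum_inner, Matrix.mulVec, dotProduct, Matrix.gram_apply]
    exact Finset.sum_congr rfl fun k _ ↦ by
      rw [real_inner_smul_left, real_inner_comm, mul_comm]
  rw [hgram, ← Matrix.cramer_apply, Matrix.cramer_eq_adjugate_mulVec, Matrix.mulVec_mulVec,
    Matrix.adjugate_mul, Matrix.smul_mulVec, Matrix.one_mulVec, Pi.smul_apply, smul_eq_mul,
    mul_div_cancel_left₀ _ (Matrix.det_gram_ne_zero_iff_linearIndependent.2 hs)]

variable {E : Type*} [NormedAddCommGroup E] [NormedSpace ℝ E]
  {H : Type*} [TopologicalSpace H] {I : ModelWithCorners ℝ E H}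
  {M : Type*} [TopologicalSpace M] [ChartedSpace H M]

theorem contMDiffAt_det {ι : Type*} [Fintype ι] [DecidableEq ι] {n : ℕ∞ω}
    {A : M → Matrix ι ι ℝ} {x : M} (hA : ∀ i j, CMDiffAt n (fun y ↦ A y i j) x) :
    CMDiffAt n (fun y ↦ (A y).det) x := by
  simp only [Matrix.det_apply, Units.smul_def, zsmul_eq_mul]
  exact contMDiffAt_finsetSum fun σ _ ↦
    contMDiffAt_const.mul (contMDiffAt_finsetProd fun i _ ↦ hA _ _)

variable [IsManifold I ∞ M] [RiemannianBundle (fun x : M ↦ TangentSpace I x)]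
  [IsContMDiffRiemannianBundle I ∞ E (fun x : M ↦ TangentSpace I x)]
  {X Y Z : Π x : M, TangentSpace I x} {x : M}

theorem contMDiffAt_inner {n : ℕ∞} (hX : CMDiffAt n (T% X) x) (hY : CMDiffAt n (T% Y) x) :
    CMDiffAt n (fun y : M ↦ inner ℝ (X y) (Y y)) x := by
  have : IsContMDiffRiemannianBundle I n E (fun x : M ↦ TangentSpace I x) :=
    IsContMDiffRiemannianBundle.of_le (n := ∞) (by exact_mod_cast le_top)
  exact ContMDiffAt.inner_bundle (IB := I) (F := E) (E := fun x : M ↦ TangentSpace I x)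
    (b := fun y ↦ y) hX hY

variable [FiniteDimensional ℝ E]

theorem contMDiffAt_of_inner {n : ℕ∞}
    (h : ∀ Z : Π x : M, TangentSpace I x, CMDiffAt ∞ (T% Z) x →
      CMDiffAt n (fun y ↦ inner ℝ (X y) (Z y)) x) :
    CMDiffAt n (T% X) x := by
  set e := trivializationAt E (TangentSpace I : M → Type _) x
  have hxe : x ∈ e.baseSet := mem_baseSet_trivializationAt E _ x
  let b := Module.finBasis ℝ E
  let s := e.localFrame b
  have hs i : CMDiffAt ∞ (T% (s i)) x := contMDiffAt_localFrame_of_mem ∞ e b i hxe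
  have hle : (n : ℕ∞ω) ≤ ∞ := by exact_mod_cast le_top
  have : ContMDiffVectorBundle n E (TangentSpace I : M → Type _) I :=
    ContMDiffVectorBundle.of_le hle
  have hG i j : CMDiffAt n (fun y ↦ Matrix.gram ℝ (fun i ↦ s i y) i j) x :=
    contMDiffAt_inner ((hs i).of_le hle) ((hs j).of_le hle)
  have hli y (hy : y ∈ e.baseSet) : LinearIndependent ℝ (fun i ↦ s i y) :=
    (e.isLocalFrameOn_localFrame_baseSet I ∞ b).linearIndependent hy
  refine (contMDiffAt_iff_localFrameCoeff b hxe).2 fun i ↦ ?_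
  have hq : CMDiffAt n (fun y ↦ ((Matrix.gram ℝ (fun i ↦ s i y)).updateCol i
      (fun j ↦ inner ℝ (X y) (s j y))).det / (Matrix.gram ℝ (fun i ↦ s i y)).det) x := by
    refine ContMDiffAt.div₀ (contMDiffAt_det fun j k ↦ ?_) (contMDiffAt_det hG)
      (Matrix.det_gram_ne_zero_iff_linearIndependent.2 (hli x hxe))
    by_cases hk : k = i
    · simpa [hk] using h (s j) (hs j)
    · simpa [Matrix.updateCol_apply, hk] using hG j k
  refine hq.congr_of_eventuallyEq ?_
  filter_upwards [e.open_baseSet.mem_nhds hxe] with y hy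
  rw [e.eq_sum_localFrameCoeff_smul (I := I) (b := b) (s := X) hy]
  simpa [s] using! coeff_eq_det_div_det_gram (hli y hy) (fun j ↦ e.localFrameCoeff I b j y (X y)) i

theorem inner_leviCivita (hX : MDiffAt (T% X) x) (hY : MDiffAt (T% Y) x) (hZ : MDiffAt (T% Z) x) :
    inner ℝ (leviCivita I Y x (X x)) (Z x) = koszul I X Y Z x :=
  inner_leviCivitaFun hX hY hZ

theorem leviCivita_sub_swap (hX : MDiffAt (T% X) x) (hY : MDiffAt (T% Y) x) :
    leviCivita I Y x (X x) - leviCivita I X x (Y x) = mlieBracket I X Y x :=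
  (CovariantDerivative.torsion_eq_zero_iff _).1 leviCivita_torsion hX hY

theorem leviCivita_metric_apply (hY : MDiffAt (T% Y) x) (hZ : MDiffAt (T% Z) x)
    (u : TangentSpace I x) :
    mvfderiv I (fun y : M ↦ inner ℝ (Y y) (Z y)) x u =
      inner ℝ (leviCivita I Y x u) (Z x) + inner ℝ (Y x) (leviCivita I Z x u) := by
  simpa only [extend_apply_self] using leviCivita_metric (mdifferentiableAt_extend I E u) hY hZ

theorem contMDiffAt_koszul (hX : CMDiffAt ∞ (T% X) x) (hY : CMDiffAt ∞ (T% Y) x)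
    (hZ : CMDiffAt ∞ (T% Z) x) : CMDiffAt ∞ (koszul I X Y Z) x := by
  have deriv {X Y Z : Π x : M, TangentSpace I x} (hX : CMDiffAt ∞ (T% X) x)
      (hY : CMDiffAt ∞ (T% Y) x) (hZ : CMDiffAt ∞ (T% Z) x) :
      CMDiffAt ∞ (fun y ↦ mvfderiv I (fun y : M ↦ inner ℝ (Y y) (Z y)) y (X y)) x :=
    contMDiffAt_mvfderiv_apply (contMDiffAt_inner (n := ⊤) hY hZ) hX le_rfl
  have bracket {X Y Z : Π x : M, TangentSpace I x} (hX : CMDiffAt ∞ (T% X) x)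
      (hY : CMDiffAt ∞ (T% Y) x) (hZ : CMDiffAt ∞ (T% Z) x) :
      CMDiffAt ∞ (fun y ↦ inner ℝ (mlieBracket I X Y y) (Z y)) x :=
    contMDiffAt_inner (n := ⊤) (contMDiffAt_mlieBracket (m := ⊤) (n := ⊤) hX hY le_rfl) hZ
  exact contMDiffAt_const.mul <| ((((deriv hX hY hZ).add (deriv hY hX hZ)).sub
    (deriv hZ hX hY)).add (bracket hX hY hZ)).sub (bracket hX hZ hY) |>.sub (bracket hY hZ hX)

theorem contMDiffAt_leviCivita (hX : CMDiffAt ∞ (T% X) x) (hY : CMDiffAt ∞ (T% Y) x) :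
    CMDiffAt ∞ (T% (fun y ↦ leviCivita I Y y (X y))) x := by
  refine contMDiffAt_of_inner (n := ⊤) fun Z hZ ↦
    (contMDiffAt_koszul hX hY hZ).congr_of_eventuallyEq ?_
  filter_upwards [eventually_mdifferentiableAt_section hX (by simp),
    eventually_mdifferentiableAt_section hY (by simp),
    eventually_mdifferentiableAt_section hZ (by simp)] with y hXy hYy hZy
  exact inner_leviCivita hXy hYy hZy

theorem mdifferentiableAt_leviCivita (hX : MDiffAt (T% X) x) (hY : CMDiffAt ∞ (T% Y) x) :
    MDiffAt (T% (fun y ↦ leviCivita I Y y (X y))) x := by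
  set e := trivializationAt E (TangentSpace I : M → Type _) x
  have hxe : x ∈ e.baseSet := mem_baseSet_trivializationAt E _ x
  let b := Module.finBasis ℝ E
  have hs i : CMDiffAt ∞ (T% (e.localFrame b i)) x := contMDiffAt_localFrame_of_mem ∞ e b i hxe
  have hsum : MDiffAt (T% (fun y ↦ ∑ i, e.localFrameCoeff I b i y (X y) •
      leviCivita I Y y (e.localFrame b i y))) x :=
    .sum_section fun i _ ↦ (mdifferentiableAt_localFrameCoeff b hxe hX i).smul_section
      ((contMDiffAt_leviCivita (hs i) hY).mdifferentiableAt (by simp))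
  refine hsum.congr_of_eventuallyEq ?_
  filter_upwards [e.open_baseSet.mem_nhds hxe] with y hy
  congr 1
  conv_lhs => rw [e.eq_sum_localFrameCoeff_smul (I := I) (b := b) (s := X) hy]
  simp only [map_sum, map_smul]

end LeviCivita

section Curvature

theorem gram_combination {V : Type*} [NormedAddCommGroup V] [InnerProductSpace ℝ V]
    (e f : V) (a b c d : ℝ) :
    ‖a • e + b • f‖ ^ 2 * ‖c • e + d • f‖ ^ 2 - inner ℝ (a • e + b • f) (c • e + d • f) ^ 2 =
      (a * d - b * c) ^ 2 * (‖e‖ ^ 2 * ‖f‖ ^ 2 - inner ℝ e f ^ 2) := by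
  simp only [← real_inner_self_eq_norm_sq, inner_add_left, inner_add_right, real_inner_smul_left,
    real_inner_smul_right, real_inner_comm e f]
  ring

theorem gram_ne_zero_iff_linearIndependent {V : Type*} [NormedAddCommGroup V]
    [InnerProductSpace ℝ V] {u v : V} :
    ‖u‖ ^ 2 * ‖v‖ ^ 2 - inner ℝ u v ^ 2 ≠ 0 ↔ LinearIndependent ℝ ![u, v] := by
  rw [← Matrix.det_gram_ne_zero_iff_linearIndependent]
  simp [Matrix.det_fin_two, Matrix.gram_apply, real_inner_comm u v, sq]

variable {E : Type*} [NormedAddCommGroup E] [NormedSpace ℝ E] [FiniteDimensional ℝ E]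
  {H : Type*} [TopologicalSpace H] {I : ModelWithCorners ℝ E H}
  {M : Type*} [TopologicalSpace M] [ChartedSpace H M] [IsManifold I ∞ M]
  [RiemannianBundle (fun x : M ↦ TangentSpace I x)]
  [IsContMDiffRiemannianBundle I ∞ E (fun x : M ↦ TangentSpace I x)]
  {X Y Z W : Π x : M, TangentSpace I x} {x : M}

theorem curvatureField_swap (X Y Z : Π x : M, TangentSpace I x) (x : M) :
    curvatureField I X Y Z x = -curvatureField I Y X Z x := by
  rw [curvatureField, curvatureField, mlieBracket_swap_apply, map_neg]
  abel

theorem leviCivita_add (hY : MDiffAt (T% Y) x) (hZ : MDiffAt (T% Z) x) (u : TangentSpace I x) :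
    leviCivita I (Y + Z) x u = leviCivita I Y x u + leviCivita I Z x u :=
  congr($((leviCivita I).isCovariantDerivativeOnUniv.add hY hZ) u)

theorem leviCivita_smul {f : M → ℝ} (hY : MDiffAt (T% Y) x) (hf : MDiffAt f x)
    (u : TangentSpace I x) :
    leviCivita I (f • Y) x u = f x • leviCivita I Y x u + mvfderiv I f x u • Y x := by
  have h := (leviCivita I).isCovariantDerivativeOnUniv.leibniz hY hf
  simpa using congr($h u)

theorem curvatureField_tensorial_left (hZ : CMDiffAt ∞ (T% Z) x) :
    TensorialAt I E (fun X ↦ curvatureField I X Y Z x) x where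
  smul {f X} hf hX := by
    have e : (fun y ↦ leviCivita I Z y ((f • X) y)) = f • fun y ↦ leviCivita I Z y (X y) := by
      ext1 y
      exact map_smul _ _ _
    simp only [curvatureField]
    rw [e, leviCivita_smul (mdifferentiableAt_leviCivita hX hZ) hf, mlieBracket_smul_left hf hX]
    simp only [Pi.smul_apply', map_smul, map_add]
    module
  add {X X'} hX hX' := by
    have e : (fun y ↦ leviCivita I Z y ((X + X') y)) =
        (fun y ↦ leviCivita I Z y (X y)) + fun y ↦ leviCivita I Z y (X' y) := by
      ext1 y
      exact map_add _ _ _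
    simp only [curvatureField]
    rw [e, leviCivita_add (mdifferentiableAt_leviCivita hX hZ)
      (mdifferentiableAt_leviCivita hX' hZ), mlieBracket_add_left hX hX']
    simp only [Pi.add_apply, map_add]
    module

theorem mvfderiv_mvfderiv_inner (hY : CMDiffAt ∞ (T% Y) x) (hZ : CMDiffAt ∞ (T% Z) x)
    (hW : CMDiffAt ∞ (T% W) x) (u : TangentSpace I x) :
    mvfderiv I (fun y ↦ mvfderiv I (fun y ↦ inner ℝ (Z y) (W y)) y (Y y)) x u =
      (inner ℝ (leviCivita I (fun y ↦ leviCivita I Z y (Y y)) x u) (W x) +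
        inner ℝ (leviCivita I Z x (Y x)) (leviCivita I W x u)) +
      (inner ℝ (leviCivita I Z x u) (leviCivita I W x (Y x)) +
        inner ℝ (Z x) (leviCivita I (fun y ↦ leviCivita I W y (Y y)) x u)) := by
  have e : (fun y ↦ mvfderiv I (fun y ↦ inner ℝ (Z y) (W y)) y (Y y)) =ᶠ[𝓝 x]
      (fun y ↦ inner ℝ (leviCivita I Z y (Y y)) (W y) +
        inner ℝ (Z y) (leviCivita I W y (Y y))) := by
    filter_upwards [eventually_mdifferentiableAt_section hZ (by simp),
      eventually_mdifferentiableAt_section hW (by simp)] with y hZy hWy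
      using leviCivita_metric_apply hZy hWy _
  have hZx : MDiffAt (T% Z) x := hZ.mdifferentiableAt (by simp)
  have hWx : MDiffAt (T% W) x := hW.mdifferentiableAt (by simp)
  have hYx : MDiffAt (T% Y) x := hY.mdifferentiableAt (by simp)
  have hYZ := mdifferentiableAt_leviCivita hYx hZ
  have hYW := mdifferentiableAt_leviCivita hYx hW
  rw [mvfderiv_congr e, mvfderiv_fun_add (mdifferentiableAt_inner hYZ hWx)
    (mdifferentiableAt_inner hZx hYW), add_apply,
    leviCivita_metric_apply hYZ hWx, leviCivita_metric_apply hZx hYW]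

theorem inner_curvatureField_skew (hX : CMDiffAt ∞ (T% X) x) (hY : CMDiffAt ∞ (T% Y) x)
    (hZ : CMDiffAt ∞ (T% Z) x) (hW : CMDiffAt ∞ (T% W) x) :
    inner ℝ (curvatureField I X Y Z x) (W x) = -inner ℝ (curvatureField I X Y W x) (Z x) := by
  have h2 : (2 : ℕ∞ω) ≤ ∞ := ENat.LEInfty.out
  have hc := mvfderiv_mlieBracket ((contMDiffAt_inner (n := ⊤) hZ hW).of_le h2)
    (hX.of_le h2) (hY.of_le h2)
  rw [mvfderiv_mvfderiv_inner hY hZ hW, mvfderiv_mvfderiv_inner hX hZ hW,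
    leviCivita_metric_apply (hZ.mdifferentiableAt (by simp)) (hW.mdifferentiableAt (by simp))]
    at hc
  simp only [curvatureField, inner_sub_left]
  simp only [real_inner_comm (Z x)] at hc ⊢
  linarith

theorem curvatureField_eq_curvature (hX : CMDiffAt ∞ (T% X) x) (hY : CMDiffAt ∞ (T% Y) x)
    (hZ : CMDiffAt ∞ (T% Z) x) :
    curvatureField I X Y Z x = curvature I x (X x) (Y x) (Z x) := by
  have hX' : CMDiffAt ∞ (T% (extend E (X x))) x := contMDiffAt_extend I E _
  have hY' : CMDiffAt ∞ (T% (extend E (Y x))) x := contMDiffAt_extend I E _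
  have hZ' : CMDiffAt ∞ (T% (extend E (Z x))) x := contMDiffAt_extend I E _
  calc curvatureField I X Y Z x
      = curvatureField I (extend E (X x)) Y Z x :=
        (curvatureField_tensorial_left hZ).pointwise (hX.mdifferentiableAt (by simp))
          (hX'.mdifferentiableAt (by simp)) (extend_apply_self E _).symm
    _ = curvatureField I (extend E (X x)) (extend E (Y x)) Z x := by
        rw [curvatureField_swap, curvatureField_swap (extend E (X x))]
        exact congrArg _ <| (curvatureField_tensorial_left hZ).pointwise
          (hY.mdifferentiableAt (by simp)) (hY'.mdifferentiableAt (by simp))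
          (extend_apply_self E _).symm
    _ = curvature I x (X x) (Y x) (Z x) := by
        refine ext_inner_right ℝ fun w ↦ ?_
        have hw : CMDiffAt ∞ (T% (extend E w : Π x : M, TangentSpace I x)) x :=
          contMDiffAt_extend I E w
        have h := inner_curvatureField_skew hX' hY' hZ hw
        have h' := inner_curvatureField_skew hX' hY' hZ' hw
        rw [extend_apply_self] at h h'
        rw [curvature, h, h', extend_apply_self]

theorem curvature_swap (u v w : TangentSpace I x) : curvature I x u v w = -curvature I x v u w :=
  curvatureField_swap _ _ _ _

theorem curvature_self (u w : TangentSpace I x) : curvature I x u u w = 0 :=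
  have : IsAddTorsionFree (TangentSpace I x) := .of_isTorsionFree ℝ _
  self_eq_neg.1 (curvature_swap u u w)

theorem curvature_combination_left (a b : ℝ) (e f v w : TangentSpace I x) :
    curvature I x (a • e + b • f) v w = a • curvature I x e v w + b • curvature I x f v w := by
  have h := map_add (TensorialAt.mkHom _ x (curvatureField_tensorial_left (Y := extend E v)
    (contMDiffAt_extend I E w))) (a • e) (b • f)
  rwa [map_smul, map_smul] at h

theorem inner_curvature_skew (u v w z : TangentSpace I x) :
    inner ℝ (curvature I x u v w) z = -inner ℝ (curvature I x u v z) w := by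
  simpa only [curvature, extend_apply_self] using
    inner_curvatureField_skew (contMDiffAt_extend I E u) (contMDiffAt_extend I E v)
      (contMDiffAt_extend I E w) (contMDiffAt_extend I E z)

theorem curvature_combination (a b c d : ℝ) (e f w : TangentSpace I x) :
    curvature I x (a • e + b • f) (c • e + d • f) w =
      (a * d - b * c) • curvature I x e f w := by
  rw [curvature_combination_left, curvature_swap e, curvature_swap f, curvature_combination_left,
    curvature_combination_left, curvature_self, curvature_self, curvature_swap f e]
  module

theorem inner_curvature_combination (a b c d : ℝ) (e f : TangentSpace I x) :
    inner ℝ (curvature I x (a • e + b • f) (c • e + d • f) (c • e + d • f)) (a • e + b • f) =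
      (a * d - b * c) ^ 2 * inner ℝ (curvature I x e f f) e := by
  have skew_self (w : TangentSpace I x) : inner ℝ (curvature I x e f w) w = 0 :=
    self_eq_neg.1 (inner_curvature_skew e f w w)
  have skew (w : TangentSpace I x) : inner ℝ (curvature I x e f w) (a • e + b • f)
      = -(a * inner ℝ (curvature I x e f e) w + b * inner ℝ (curvature I x e f f) w) := by
    rw [inner_add_right, real_inner_smul_right, real_inner_smul_right,
      inner_curvature_skew e f w e, inner_curvature_skew e f w f]
    ring
  rw [curvature_combination, real_inner_smul_left, skew]
  simp only [inner_add_right, real_inner_smul_right, skew_self, inner_curvature_skew e f e f]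
  ring

theorem sectionalCurvature_eq_of_mem_span {e f u v : TangentSpace I x}
    (hu : u ∈ Submodule.span ℝ {e, f}) (hv : v ∈ Submodule.span ℝ {e, f})
    (huv : LinearIndependent ℝ ![u, v]) :
    sectionalCurvature I x u v = sectionalCurvature I x e f := by
  obtain ⟨a, b, rfl⟩ := Submodule.mem_span_pair.1 hu
  obtain ⟨c, d, rfl⟩ := Submodule.mem_span_pair.1 hv
  have gram_ne_zero := gram_ne_zero_iff_linearIndependent.2 huv
  rw [gram_combination] at gram_ne_zero
  rw [sectionalCurvature, sectionalCurvature, gram_combination, inner_curvature_combination,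
    mul_div_mul_left _ _ (left_ne_zero_of_mul gram_ne_zero)]

theorem gaussCurvature_eq_sectionalCurvature {B : Type*} [TopologicalSpace B]
    [ChartedSpace (EuclideanSpace ℝ (Fin 2)) B] [IsManifold (𝓡 2) ∞ B]
    [RiemannianBundle (fun b : B ↦ TangentSpace (𝓡 2) b)]
    [IsContMDiffRiemannianBundle (𝓡 2) ∞ (EuclideanSpace ℝ (Fin 2))
      (fun b : B ↦ TangentSpace (𝓡 2) b)] {b : B} {u v : TangentSpace (𝓡 2) b}
    (h : LinearIndependent ℝ ![u, v]) :
    gaussCurvature b = sectionalCurvature (𝓡 2) b u v := by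
  have mem_span (w : EuclideanSpace ℝ (Fin 2)) : w ∈ Submodule.span ℝ
      {EuclideanSpace.single 0 (1 : ℝ), EuclideanSpace.single 1 (1 : ℝ)} :=
    Submodule.mem_span_pair.2 ⟨w 0, w 1, by ext i; fin_cases i <;> simp⟩
  exact (sectionalCurvature_eq_of_mem_span (mem_span u) (mem_span v) h).symm

end Curvature

theorem comp_adjoint_eq_id {V W : Type*} [NormedAddCommGroup V] [InnerProductSpace ℝ V]
    [CompleteSpace V] [NormedAddCommGroup W] [InnerProductSpace ℝ W] [CompleteSpace W]
    {D : V →L[ℝ] W} (hsurj : Function.Surjective D)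
    (hnorm : ∀ u ∈ (LinearMap.ker D.toLinearMap)ᗮ, ‖D u‖ = ‖u‖) :
    D ∘L ContinuousLinearMap.adjoint D = .id ℝ W := by
  set K := LinearMap.ker D.toLinearMap
  let L : Kᗮ →ₗᵢ[ℝ] W := ⟨D.toLinearMap ∘ₗ Kᗮ.subtype, fun u ↦ hnorm u u.2⟩
  have adjoint_mem (w : W) : ContinuousLinearMap.adjoint D w ∈ Kᗮ := fun z hz ↦ by
    rw [ContinuousLinearMap.adjoint_inner_right, show D z = 0 from hz, inner_zero_left]
  have : CompleteSpace K := D.isClosed_ker.completeSpace_coe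
  ext w
  refine ext_inner_right ℝ fun w' ↦ ?_
  obtain ⟨v, rfl⟩ := hsurj w'
  obtain ⟨k, hk, z, hz, rfl⟩ := K.exists_add_mem_mem_orthogonal v
  rw [map_add, show D k = 0 from hk, zero_add]
  calc inner ℝ (D (ContinuousLinearMap.adjoint D w)) (D z)
      = inner ℝ (ContinuousLinearMap.adjoint D w) z := L.inner_map_map ⟨_, adjoint_mem w⟩ ⟨z, hz⟩
    _ = inner ℝ w (D z) := ContinuousLinearMap.adjoint_inner_left _ _ _

section RiemannianSubmersion

variable {E : Type*} [NormedAddCommGroup E] [NormedSpace ℝ E] [FiniteDimensional ℝ E]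
  {H : Type*} [TopologicalSpace H] {I : ModelWithCorners ℝ E H}
  {M : Type*} [TopologicalSpace M] [ChartedSpace H M]
  [RiemannianBundle (fun x : M ↦ TangentSpace I x)]
  {E' : Type*} [NormedAddCommGroup E'] [NormedSpace ℝ E'] [FiniteDimensional ℝ E']
  {H' : Type*} [TopologicalSpace H'] {I' : ModelWithCorners ℝ E' H'}
  {M' : Type*} [TopologicalSpace M'] [ChartedSpace H' M']
  [RiemannianBundle (fun x : M' ↦ TangentSpace I' x)]
  {g : M → M'} {q : M}

variable (I I') in
/-- A Riemannian submersion between manifolds of any dimensions, not necessarily onto: a smooth map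
whose differential `D` restricts to an isometry from `(ker D)ᗮ` onto the tangent space of the
target, which is expressed by `D D† = 1`. -/
structure IsCoisometric (g : M → M') : Prop where
  smooth : CMDiff ∞ g
  mfderiv_comp_adjoint : ∀ q : M,
    mfderiv I I' g q ∘L ContinuousLinearMap.adjoint (mfderiv I I' g q) = .id ℝ _

variable (I) in
/-- The horizontal lift of the vector field `W` along `g`, given at each point by the adjoint of
the differential; it is a lift as soon as `g` is coisometric. -/
def horizontalLift (g : M → M') (W : Π b : M', TangentSpace I' b) (q : M) : TangentSpace I q :=
  ContinuousLinearMap.adjoint (mfderiv I I' g q) (W (g q))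

variable (I I') in
/-- The vertical part `w - D† D w` of a tangent vector `w`: for a coisometric map, its orthogonal
projection to the kernel of the differential `D`. -/
def verticalPart (g : M → M') (q : M) (w : TangentSpace I q) : TangentSpace I q :=
  w - ContinuousLinearMap.adjoint (mfderiv I I' g q) (mfderiv I I' g q w)

variable {W X Y Z : Π b : M', TangentSpace I' b}

theorem inner_horizontalLift (W : Π b : M', TangentSpace I' b) (z : TangentSpace I q) :
    inner ℝ (horizontalLift I g W q) z = inner ℝ (W (g q)) (mfderiv I I' g q z) :=
  ContinuousLinearMap.adjoint_inner_left _ _ _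

theorem inner_verticalPart_left (w z : TangentSpace I q) :
    inner ℝ (verticalPart I I' g q w) z = inner ℝ w (verticalPart I I' g q z) := by
  simp only [verticalPart, inner_sub_left, inner_sub_right, ContinuousLinearMap.adjoint_inner_left,
    ContinuousLinearMap.adjoint_inner_right]

theorem horizontalLift_add_verticalPart {w : TangentSpace I q}
    (hw : mfderiv I I' g q w = W (g q)) :
    horizontalLift I g W q + verticalPart I I' g q w = w := by
  rw [horizontalLift, verticalPart, hw, add_sub_cancel]

section Smoothness

variable [IsManifold I ∞ M] [IsManifold I' ∞ M']
  [IsContMDiffRiemannianBundle I ∞ E (fun x : M ↦ TangentSpace I x)]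
  [IsContMDiffRiemannianBundle I' ∞ E' (fun x : M' ↦ TangentSpace I' x)]

theorem contMDiffAt_adjoint_mfderiv {n : ℕ∞} {σ : Π q : M, TangentSpace I' (g q)}
    (hg : CMDiffAt ∞ g q)
    (hσ : ContMDiffAt I I'.tangent n (fun y ↦ (⟨g y, σ y⟩ : TangentBundle I' M')) q) :
    CMDiffAt n (T% (fun y ↦ ContinuousLinearMap.adjoint (mfderiv I I' g y) (σ y))) q := by
  have hle : (n : ℕ∞ω) ≤ ∞ := by exact_mod_cast le_top
  have : IsContMDiffRiemannianBundle I' n E' (fun x : M' ↦ TangentSpace I' x) :=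
    IsContMDiffRiemannianBundle.of_le hle
  refine contMDiffAt_of_inner fun Z hZ ↦ ?_
  simp only [ContinuousLinearMap.adjoint_inner_left]
  exact ContMDiffAt.inner_bundle (IB := I') (F := E') (E := fun b : M' ↦ TangentSpace I' b)
    (b := g) hσ ((contMDiffAt_mfderiv_apply hg hZ le_rfl).of_le hle)

theorem contMDiffAt_horizontalLift {n : ℕ∞} (hg : CMDiffAt ∞ g q)
    (hW : CMDiffAt n (T% W) (g q)) : CMDiffAt n (T% (horizontalLift I g W)) q :=
  contMDiffAt_adjoint_mfderiv hg <| hW.comp q (hg.of_le (by exact_mod_cast le_top))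

theorem contMDiffAt_verticalPart {w : Π q : M, TangentSpace I q} (hg : CMDiffAt ∞ g q)
    (hw : CMDiffAt ∞ (T% w) q) : CMDiffAt ∞ (T% (fun y ↦ verticalPart I I' g y (w y))) q :=
  hw.sub_section <|
    contMDiffAt_adjoint_mfderiv (n := ⊤) hg (contMDiffAt_mfderiv_apply hg hw le_rfl)

end Smoothness

namespace IsCoisometric

variable (hg : IsCoisometric I I' g)
include hg

theorem mfderiv_adjoint (w : TangentSpace I' (g q)) :
    mfderiv I I' g q (ContinuousLinearMap.adjoint (mfderiv I I' g q) w) = w :=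
  DFunLike.congr_fun (hg.mfderiv_comp_adjoint q) w

theorem mfderiv_horizontalLift (W : Π b : M', TangentSpace I' b) (q : M) :
    mfderiv I I' g q (horizontalLift I g W q) = W (g q) :=
  hg.mfderiv_adjoint _

theorem mfderiv_verticalPart (w : TangentSpace I q) :
    mfderiv I I' g q (verticalPart I I' g q w) = 0 := by
  rw [verticalPart, map_sub, hg.mfderiv_adjoint, sub_self]

theorem inner_horizontalLift_horizontalLift (W Z : Π b : M', TangentSpace I' b) (q : M) :
    inner ℝ (horizontalLift I g W q) (horizontalLift I g Z q) = inner ℝ (W (g q)) (Z (g q)) := by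
  rw [inner_horizontalLift, hg.mfderiv_horizontalLift]

variable [IsManifold I' ∞ M']
  [IsContMDiffRiemannianBundle I' ∞ E' (fun x : M' ↦ TangentSpace I' x)]

theorem mvfderiv_inner_horizontalLift (hY : CMDiffAt 2 (T% Y) (g q))
    (hZ : CMDiffAt 2 (T% Z) (g q)) (u : TangentSpace I q) :
    mvfderiv I (fun y ↦ inner ℝ (horizontalLift I g Y y) (horizontalLift I g Z y)) q u =
      mvfderiv I' (fun y ↦ inner ℝ (Y y) (Z y)) (g q) (mfderiv I I' g q u) := by
  simp only [hg.inner_horizontalLift_horizontalLift]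
  exact mvfderiv_comp_apply q (mdifferentiableAt_inner (hY.mdifferentiableAt two_ne_zero)
    (hZ.mdifferentiableAt two_ne_zero)) (hg.smooth.mdifferentiableAt (by simp)) u

variable [IsManifold I ∞ M] [IsContMDiffRiemannianBundle I ∞ E (fun x : M ↦ TangentSpace I x)]

theorem mdifferentiableAt_horizontalLift (hW : CMDiffAt 2 (T% W) (g q)) :
    MDiffAt (T% (horizontalLift I g W)) q :=
  (contMDiffAt_horizontalLift (n := 2) hg.smooth.contMDiffAt hW).mdifferentiableAt two_ne_zero

theorem mfderiv_mlieBracket_horizontalLift (hX : CMDiffAt 2 (T% X) (g q))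
    (hY : CMDiffAt 2 (T% Y) (g q)) :
    mfderiv I I' g q (mlieBracket I (horizontalLift I g X) (horizontalLift I g Y) q) =
      mlieBracket I' X Y (g q) :=
  mfderiv_mlieBracket_of_related (hg.smooth.contMDiffAt.of_le ENat.LEInfty.out)
    (contMDiffAt_horizontalLift (n := 2) hg.smooth.contMDiffAt hX)
    (contMDiffAt_horizontalLift (n := 2) hg.smooth.contMDiffAt hY) hX hY
    (.of_forall (hg.mfderiv_horizontalLift X)) (.of_forall (hg.mfderiv_horizontalLift Y))

theorem inner_mlieBracket_horizontalLift (hX : CMDiffAt 2 (T% X) (g q))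
    (hY : CMDiffAt 2 (T% Y) (g q)) (Z : Π b : M', TangentSpace I' b) :
    inner ℝ (mlieBracket I (horizontalLift I g X) (horizontalLift I g Y) q)
      (horizontalLift I g Z q) = inner ℝ (mlieBracket I' X Y (g q)) (Z (g q)) := by
  rw [real_inner_comm, inner_horizontalLift, hg.mfderiv_mlieBracket_horizontalLift hX hY,
    real_inner_comm]

theorem koszul_horizontalLift (hX : CMDiffAt 2 (T% X) (g q)) (hY : CMDiffAt 2 (T% Y) (g q))
    (hZ : CMDiffAt 2 (T% Z) (g q)) :
    koszul I (horizontalLift I g X) (horizontalLift I g Y) (horizontalLift I g Z) q =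
      koszul I' X Y Z (g q) := by
  simp only [koszul, hg.mvfderiv_inner_horizontalLift hY hZ,
    hg.mvfderiv_inner_horizontalLift hX hZ, hg.mvfderiv_inner_horizontalLift hX hY,
    hg.inner_mlieBracket_horizontalLift hX hY, hg.inner_mlieBracket_horizontalLift hX hZ,
    hg.inner_mlieBracket_horizontalLift hY hZ, hg.mfderiv_horizontalLift]

theorem mfderiv_leviCivita_horizontalLift (hX : CMDiffAt 2 (T% X) (g q))
    (hY : CMDiffAt 2 (T% Y) (g q)) :
    mfderiv I I' g q (leviCivita I (horizontalLift I g Y) q (horizontalLift I g X q)) =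
      leviCivita I' Y (g q) (X (g q)) := by
  refine ext_inner_left ℝ fun z ↦ ?_
  have hZ : CMDiffAt 2 (T% (extend E' z : Π b : M', TangentSpace I' b)) (g q) :=
    (contMDiffAt_extend I' E' z).of_le ENat.LEInfty.out
  calc inner ℝ z (mfderiv I I' g q
        (leviCivita I (horizontalLift I g Y) q (horizontalLift I g X q)))
      = inner ℝ (leviCivita I (horizontalLift I g Y) q (horizontalLift I g X q))
          (horizontalLift I g (extend E' z) q) := by
        rw [real_inner_comm (horizontalLift I g _ q), inner_horizontalLift, extend_apply_self]
    _ = koszul I (horizontalLift I g X) (horizontalLift I g Y)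
          (horizontalLift I g (extend E' z)) q :=
        inner_leviCivita (hg.mdifferentiableAt_horizontalLift hX)
          (hg.mdifferentiableAt_horizontalLift hY) (hg.mdifferentiableAt_horizontalLift hZ)
    _ = koszul I' X Y (extend E' z) (g q) := hg.koszul_horizontalLift hX hY hZ
    _ = inner ℝ z (leviCivita I' Y (g q) (X (g q))) := by
        rw [real_inner_comm]
        simpa only [extend_apply_self] using (inner_leviCivita (hX.mdifferentiableAt two_ne_zero)
          (hY.mdifferentiableAt two_ne_zero) (hZ.mdifferentiableAt two_ne_zero)).symm

theorem inner_leviCivita_horizontalLift_of_vertical (hX : CMDiffAt 2 (T% X) (g q))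
    (hY : CMDiffAt 2 (T% Y) (g q)) {v : TangentSpace I q} (hv : mfderiv I I' g q v = 0) :
    inner ℝ (leviCivita I (horizontalLift I g X) q v) (horizontalLift I g Y q) =
      -inner ℝ (leviCivita I (horizontalLift I g Y) q (horizontalLift I g X q)) v := by
  set V : Π q : M, TangentSpace I q := fun y ↦ verticalPart I I' g y (extend E v y)
  have hV : CMDiffAt ∞ (T% V) q :=
    contMDiffAt_verticalPart hg.smooth.contMDiffAt (contMDiffAt_extend I E v)
  have hVq : V q = v := by
    simp only [V, extend_apply_self, verticalPart, hv, map_zero, sub_zero]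
  have hVd : MDiffAt (T% V) q := hV.mdifferentiableAt (by simp)
  have hXl := contMDiffAt_horizontalLift (n := 2) hg.smooth.contMDiffAt hX
  have hXd := hg.mdifferentiableAt_horizontalLift hX
  have hYd := hg.mdifferentiableAt_horizontalLift hY
  have bracket_vertical : mfderiv I I' g q (mlieBracket I (horizontalLift I g X) V q) = 0 := by
    have h0 : CMDiffAt 2 (T% (0 : Π b : M', TangentSpace I' b)) (g q) :=
      contMDiff_zeroSection ℝ (TangentSpace I' : M' → Type _) (g q)
    rw [mfderiv_mlieBracket_of_related (hg.smooth.contMDiffAt.of_le ENat.LEInfty.out) hXl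
      (hV.of_le ENat.LEInfty.out) hX h0 (.of_forall (hg.mfderiv_horizontalLift X))
      (.of_forall fun y ↦ hg.mfderiv_verticalPart _), mlieBracket_zero_right, Pi.zero_apply]
  have torsion := congr(inner ℝ $(leviCivita_sub_swap hXd hVd) (horizontalLift I g Y q))
  rw [real_inner_comm _ (mlieBracket I _ _ _), inner_horizontalLift, bracket_vertical,
    inner_zero_right, inner_sub_left, hVq] at torsion
  have metric := leviCivita_metric_apply hVd hYd (horizontalLift I g X q)
  rw [mvfderiv_eq_zero_of_eventually_eq (c := 0) (.of_forall fun y ↦ ?_), zero_apply,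
    hVq] at metric
  · rw [real_inner_comm v]
    linarith
  · rw [real_inner_comm, inner_horizontalLift, hg.mfderiv_verticalPart, inner_zero_right]

theorem inner_leviCivita_horizontalLift_swap (hX : CMDiffAt 2 (T% X) (g q))
    (hY : CMDiffAt 2 (T% Y) (g q)) {v : TangentSpace I q} (hv : mfderiv I I' g q v = 0) :
    inner ℝ (leviCivita I (horizontalLift I g X) q (horizontalLift I g Y q)) v =
      -inner ℝ (leviCivita I (horizontalLift I g Y) q (horizontalLift I g X q)) v := by
  have metric := leviCivita_metric_apply (hg.mdifferentiableAt_horizontalLift hX)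
    (hg.mdifferentiableAt_horizontalLift hY) v
  rw [hg.mvfderiv_inner_horizontalLift hX hY, hv, map_zero,
    real_inner_comm _ (horizontalLift I g X q),
    hg.inner_leviCivita_horizontalLift_of_vertical hX hY hv,
    hg.inner_leviCivita_horizontalLift_of_vertical hY hX hv] at metric
  linarith

theorem inner_leviCivita_of_related {W : Π q : M, TangentSpace I q}
    {W' : Π b : M', TangentSpace I' b} (hX : CMDiffAt 2 (T% X) (g q))
    (hZ : CMDiffAt 2 (T% Z) (g q)) (hW : MDiffAt (T% W) q) (hW' : CMDiffAt 2 (T% W') (g q))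
    (hWW' : ∀ᶠ y in 𝓝 q, mfderiv I I' g y (W y) = W' (g y)) :
    inner ℝ (leviCivita I W q (horizontalLift I g X q)) (horizontalLift I g Z q) =
      inner ℝ (leviCivita I' W' (g q) (X (g q))) (Z (g q)) -
        inner ℝ (leviCivita I (horizontalLift I g Z) q (horizontalLift I g X q))
          (verticalPart I I' g q (W q)) := by
  have hZd := hg.mdifferentiableAt_horizontalLift hZ
  have hW'd := hg.mdifferentiableAt_horizontalLift hW'
  have base : inner ℝ (leviCivita I (horizontalLift I g W') q (horizontalLift I g X q))
      (horizontalLift I g Z q) = inner ℝ (leviCivita I' W' (g q) (X (g q))) (Z (g q)) := by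
    rw [real_inner_comm, inner_horizontalLift, hg.mfderiv_leviCivita_horizontalLift hX hW',
      real_inner_comm]
  have inner_eq : (fun y ↦ inner ℝ (W y) (horizontalLift I g Z y)) =ᶠ[𝓝 q]
      fun y ↦ inner ℝ (horizontalLift I g W' y) (horizontalLift I g Z y) := by
    filter_upwards [hWW'] with y hy
    rw [hg.inner_horizontalLift_horizontalLift, real_inner_comm, inner_horizontalLift, hy,
      real_inner_comm]
  have metric := leviCivita_metric_apply hW hZd (horizontalLift I g X q)
  rw [mvfderiv_congr inner_eq, leviCivita_metric_apply hW'd hZd, base] at metric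
  have split := horizontalLift_add_verticalPart hWW'.self_of_nhds
  rw [← split, inner_add_left, real_inner_comm _ (verticalPart I I' g q _)] at metric
  linarith

theorem verticalPart_mlieBracket_horizontalLift (hX : CMDiffAt 2 (T% X) (g q))
    (hY : CMDiffAt 2 (T% Y) (g q)) :
    verticalPart I I' g q (mlieBracket I (horizontalLift I g X) (horizontalLift I g Y) q) =
      (2 : ℝ) • verticalPart I I' g q
        (leviCivita I (horizontalLift I g Y) q (horizontalLift I g X q)) := by
  refine ext_inner_right ℝ fun w ↦ ?_
  have swap := hg.inner_leviCivita_horizontalLift_swap hX hY (hg.mfderiv_verticalPart w)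
  rw [inner_smul_left_eq_smul, inner_verticalPart_left, inner_verticalPart_left,
    ← leviCivita_sub_swap (hg.mdifferentiableAt_horizontalLift hX)
      (hg.mdifferentiableAt_horizontalLift hY), inner_sub_left, swap, sub_neg_eq_add, two_smul]

theorem inner_leviCivita_leviCivita_horizontalLift (hX : CMDiffAt ∞ (T% X) (g q))
    (hY : CMDiffAt ∞ (T% Y) (g q)) (hZ : CMDiffAt ∞ (T% Z) (g q))
    (hW : CMDiffAt ∞ (T% W) (g q)) :
    inner ℝ (leviCivita I
        (fun y ↦ leviCivita I (horizontalLift I g Z) y (horizontalLift I g Y y)) q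
        (horizontalLift I g X q)) (horizontalLift I g W q) =
      inner ℝ (leviCivita I' (fun b ↦ leviCivita I' Z b (Y b)) (g q) (X (g q))) (W (g q)) -
        inner ℝ (leviCivita I (horizontalLift I g W) q (horizontalLift I g X q))
          (verticalPart I I' g q
            (leviCivita I (horizontalLift I g Z) q (horizontalLift I g Y q))) := by
  have le2 : (2 : ℕ∞ω) ≤ ∞ := ENat.LEInfty.out
  have eventually_C2 {V : Π b : M', TangentSpace I' b} (hV : CMDiffAt ∞ (T% V) (g q)) :
      ∀ᶠ y in 𝓝 q, CMDiffAt 2 (T% V) (g y) :=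
    hg.smooth.continuous.continuousAt.eventually
      ((contMDiffAt_iff_contMDiffAt_nhds (by simp)).1 (hV.of_le le2))
  refine hg.inner_leviCivita_of_related (W' := fun b ↦ leviCivita I' Z b (Y b)) (hX.of_le le2)
    (hW.of_le le2)
    (mdifferentiableAt_leviCivita (hg.mdifferentiableAt_horizontalLift (hY.of_le le2))
      (contMDiffAt_horizontalLift (n := ⊤) hg.smooth.contMDiffAt hZ))
    ((contMDiffAt_leviCivita hY hZ).of_le le2) ?_
  filter_upwards [eventually_C2 hY, eventually_C2 hZ] with y hYy hZy
  exact hg.mfderiv_leviCivita_horizontalLift hYy hZy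

theorem inner_leviCivita_mlieBracket_horizontalLift (hX : CMDiffAt 2 (T% X) (g q))
    (hY : CMDiffAt 2 (T% Y) (g q)) (hZ : CMDiffAt 2 (T% Z) (g q)) (hW : CMDiffAt 2 (T% W) (g q)) :
    inner ℝ (leviCivita I (horizontalLift I g Z) q
        (mlieBracket I (horizontalLift I g X) (horizontalLift I g Y) q))
        (horizontalLift I g W q) =
      inner ℝ (leviCivita I' Z (g q) (mlieBracket I' X Y (g q))) (W (g q)) -
        2 * inner ℝ (leviCivita I (horizontalLift I g W) q (horizontalLift I g Z q))
          (verticalPart I I' g q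
            (leviCivita I (horizontalLift I g Y) q (horizontalLift I g X q))) := by
  set V : Π b : M', TangentSpace I' b := extend E' (mlieBracket I' X Y (g q))
  have hVq : V (g q) = mlieBracket I' X Y (g q) := extend_apply_self E' _
  have hV : CMDiffAt 2 (T% V) (g q) := (contMDiffAt_extend I' E' _).of_le ENat.LEInfty.out
  have split := horizontalLift_add_verticalPart
    ((hg.mfderiv_mlieBracket_horizontalLift hX hY).trans hVq.symm)
  have horizontal : inner ℝ (leviCivita I (horizontalLift I g Z) q (horizontalLift I g V q))
      (horizontalLift I g W q) = inner ℝ (leviCivita I' Z (g q) (V (g q))) (W (g q)) := by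
    rw [real_inner_comm, inner_horizontalLift, hg.mfderiv_leviCivita_horizontalLift hV hZ,
      real_inner_comm]
  rw [← split, map_add, inner_add_left, horizontal, hVq,
    hg.inner_leviCivita_horizontalLift_of_vertical hZ hW (hg.mfderiv_verticalPart _),
    hg.verticalPart_mlieBracket_horizontalLift hX hY, inner_smul_right, sub_eq_add_neg]

/-- O'Neill's formula. -/
theorem inner_curvatureField_horizontalLift (hX : CMDiffAt ∞ (T% X) (g q))
    (hY : CMDiffAt ∞ (T% Y) (g q)) (hZ : CMDiffAt ∞ (T% Z) (g q))
    (hW : CMDiffAt ∞ (T% W) (g q)) :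
    inner ℝ (curvatureField I (horizontalLift I g X) (horizontalLift I g Y)
        (horizontalLift I g Z) q) (horizontalLift I g W q) =
      inner ℝ (curvatureField I' X Y Z (g q)) (W (g q)) -
        inner ℝ (leviCivita I (horizontalLift I g W) q (horizontalLift I g X q))
          (verticalPart I I' g q
            (leviCivita I (horizontalLift I g Z) q (horizontalLift I g Y q))) +
        inner ℝ (leviCivita I (horizontalLift I g W) q (horizontalLift I g Y q))
          (verticalPart I I' g q
            (leviCivita I (horizontalLift I g Z) q (horizontalLift I g X q))) +
        2 * inner ℝ (leviCivita I (horizontalLift I g W) q (horizontalLift I g Z q))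
          (verticalPart I I' g q
            (leviCivita I (horizontalLift I g Y) q (horizontalLift I g X q))) := by
  have le2 : (2 : ℕ∞ω) ≤ ∞ := ENat.LEInfty.out
  simp only [curvatureField, inner_sub_left]
  rw [hg.inner_leviCivita_leviCivita_horizontalLift hX hY hZ hW,
    hg.inner_leviCivita_leviCivita_horizontalLift hY hX hZ hW,
    hg.inner_leviCivita_mlieBracket_horizontalLift (hX.of_le le2) (hY.of_le le2) (hZ.of_le le2)
      (hW.of_le le2)]
  ring

end IsCoisometric

end RiemannianSubmersion

section Killing

variable {E : Type*} [NormedAddCommGroup E] [NormedSpace ℝ E]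
  {H : Type*} [TopologicalSpace H] {I : ModelWithCorners ℝ E H}
  {M : Type*} [TopologicalSpace M] [ChartedSpace H M] [IsManifold I ∞ M]
  [RiemannianBundle (fun x : M ↦ TangentSpace I x)] {ξ : Π x : M, TangentSpace I x}

theorem IsKilling.mdifferentiableAt (hξ : IsKilling I ξ) (x : M) : MDiffAt (T% ξ) x :=
  (hξ.smooth x).mdifferentiableAt (by simp)

variable [FiniteDimensional ℝ E]
  [IsContMDiffRiemannianBundle I ∞ E (fun x : M ↦ TangentSpace I x)]

namespace IsKilling

variable (hξ : IsKilling I ξ)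
include hξ

theorem inner_leviCivita_skew (x : M) (u w : TangentSpace I x) :
    inner ℝ (leviCivita I ξ x u) w = -inner ℝ (leviCivita I ξ x w) u := by
  have hu := mdifferentiableAt_extend I E (V := (TangentSpace I : M → Type _)) u
  have hw := mdifferentiableAt_extend I E (V := (TangentSpace I : M → Type _)) w
  have lie := hξ.lie_metric x _ _ hu hw
  rw [leviCivita_metric_apply hu hw, ← leviCivita_sub_swap (hξ.mdifferentiableAt x) hu,
    ← leviCivita_sub_swap (hξ.mdifferentiableAt x) hw] at lie
  simp only [extend_apply_self, inner_sub_left, inner_sub_right] at lie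
  rw [real_inner_comm _ (leviCivita I ξ x w)]
  linarith

theorem inner_leviCivita_self (x : M) (u : TangentSpace I x) :
    inner ℝ (leviCivita I ξ x u) u = 0 :=
  self_eq_neg.1 (hξ.inner_leviCivita_skew x u u)

end IsKilling

theorem inner_leviCivita_of_norm_eq_one (hunit : ∀ x, ‖ξ x‖ = 1) {x : M} (hξ : MDiffAt (T% ξ) x)
    (u : TangentSpace I x) : inner ℝ (leviCivita I ξ x u) (ξ x) = 0 := by
  have metric := leviCivita_metric_apply hξ hξ u
  simp only [real_inner_self_eq_norm_sq, hunit, mvfderiv_const, zero_apply] at metric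
  rw [real_inner_comm _ (ξ x)] at metric
  linarith

namespace IsKilling

variable (hξ : IsKilling I ξ) (hunit : ∀ x, ‖ξ x‖ = 1)
include hξ hunit

theorem leviCivita_self (x : M) : leviCivita I ξ x (ξ x) = 0 := by
  refine ext_inner_right ℝ fun w ↦ ?_
  rw [hξ.inner_leviCivita_skew, inner_leviCivita_of_norm_eq_one hunit (hξ.mdifferentiableAt x),
    inner_zero_left, neg_zero]

theorem inner_curvature_self (x : M) (u : TangentSpace I x) :
    inner ℝ (curvature I x u (ξ x) (ξ x)) u = ‖leviCivita I ξ x u‖ ^ 2 := by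
  set X : Π x : M, TangentSpace I x := extend E u
  have hX : CMDiffAt ∞ (T% X) x := contMDiffAt_extend I E u
  have hXx : X x = u := extend_apply_self _ _
  have hXd : MDiffAt (T% X) x := hX.mdifferentiableAt (by simp)
  have hξx : CMDiffAt ∞ (T% ξ) x := hξ.smooth x
  have geodesic : (fun y ↦ leviCivita I ξ y (ξ y)) = 0 := funext (hξ.leviCivita_self hunit)
  have metric := leviCivita_metric_apply (mdifferentiableAt_leviCivita hXd hξx) hXd (ξ x)
  simp only [hξ.inner_leviCivita_self, mvfderiv_const, zero_apply] at metric
  have torsion := leviCivita_sub_swap hXd (hξ.mdifferentiableAt x)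
  have tensor := curvatureField_eq_curvature hX hξx hξx
  rw [hXx] at tensor torsion metric
  rw [← tensor, curvatureField, geodesic, CovariantDerivative.zero, ← torsion]
  simp only [Pi.zero_apply, zero_apply, zero_sub, inner_sub_left, inner_neg_left, hXx]
  rw [hξ.inner_leviCivita_skew x (_ - _) u, inner_sub_right, real_inner_self_eq_norm_sq]
  linarith

theorem sectionalCurvature_self (x : M) (u : TangentSpace I x) :
    sectionalCurvature I x u (ξ x) =
      ‖leviCivita I ξ x u‖ ^ 2 / (‖u‖ ^ 2 - inner ℝ u (ξ x) ^ 2) := by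
  rw [sectionalCurvature, hξ.inner_curvature_self hunit, hunit, one_pow, mul_one]

end IsKilling

end Killing

section CrossProduct

theorem exists_orthonormalBasis_apply_eq {ι V : Type*} [Fintype ι] [NormedAddCommGroup V]
    [InnerProductSpace ℝ V] [FiniteDimensional ℝ V]
    (hcard : Module.finrank ℝ V = Fintype.card ι) (i : ι) {n : V} (hn : ‖n‖ = 1) :
    ∃ b : OrthonormalBasis ι ℝ V, b i = n := by
  have hv : Orthonormal ℝ (({i} : Set ι).domRestrict fun _ ↦ n) :=
    ⟨fun _ ↦ hn, fun j k hjk ↦ (hjk (Subsingleton.elim j k)).elim⟩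
  obtain ⟨b, hb⟩ := hv.exists_orthonormalBasis_extension_of_card_eq hcard
  exact ⟨b, hb i rfl⟩

variable {M : Type*} [TopologicalSpace M] [ChartedSpace (EuclideanSpace ℝ (Fin 3)) M]
  [IsManifold (𝓡 3) ∞ M] [RiemannianBundle (fun x : M ↦ TangentSpace (𝓡 3) x)]
  (o : ManifoldOrientation M) {x : M}

theorem exists_inner_cross_eq (b : OrthonormalBasis (Fin 3) ℝ (TangentSpace (𝓡 3) x)) :
    ∃ d : ℝ, d ^ 2 = 1 ∧ ∀ u w, inner ℝ (cross o u (b 2)) w =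
      d * (inner ℝ (b 0) u * inner ℝ (b 1) w - inner ℝ (b 1) u * inner ℝ (b 0) w) := by
  have det_eq (u w : TangentSpace (𝓡 3) x) : b.toBasis.det ![u, b 2, w] =
      -(inner ℝ (b 0) u * inner ℝ (b 1) w - inner ℝ (b 1) u * inner ℝ (b 0) w) := by
    simp only [Module.Basis.det_apply, Matrix.det_fin_three, Module.Basis.toMatrix_apply,
      OrthonormalBasis.coe_toBasis_repr_apply, OrthonormalBasis.repr_apply_apply,
      orthonormal_iff_ite.1 b.orthonormal, Matrix.cons_val_zero, Matrix.cons_val_one,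
      Matrix.cons_val, Fin.reduceEq, ↓reduceIte]
    ring
  by_cases ho : b.toBasis.orientation = o.orient x
  · refine ⟨-1, by norm_num, fun u w ↦ ?_⟩
    rw [inner_cross, (o.orient x).volumeForm_robust b ho, det_eq]
    ring
  · refine ⟨1, by norm_num, fun u w ↦ ?_⟩
    rw [inner_cross, (o.orient x).volumeForm_robust_neg b ho, AlternatingMap.neg_apply, det_eq]
    ring

variable {n : TangentSpace (𝓡 3) x} (hn : ‖n‖ = 1)
include hn

theorem exists_orthonormalBasis_inner_cross_eq :
    ∃ b : OrthonormalBasis (Fin 3) ℝ (TangentSpace (𝓡 3) x), b 2 = n ∧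
      ∃ d : ℝ, d ^ 2 = 1 ∧ ∀ u w, inner ℝ (cross o u n) w =
        d * (inner ℝ (b 0) u * inner ℝ (b 1) w - inner ℝ (b 1) u * inner ℝ (b 0) w) := by
  obtain ⟨b, rfl⟩ := exists_orthonormalBasis_apply_eq
    (show Module.finrank ℝ (TangentSpace (𝓡 3) x) = Fintype.card (Fin 3) from
      Fact.out (p := Module.finrank ℝ (TangentSpace (𝓡 3) x) = 3)) 2 hn
  exact ⟨b, rfl, exists_inner_cross_eq o b⟩

theorem norm_sq_cross (u : TangentSpace (𝓡 3) x) :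
    ‖cross o u n‖ ^ 2 = ‖u‖ ^ 2 - inner ℝ u n ^ 2 := by
  obtain ⟨b, rfl, d, hd, h⟩ := exists_orthonormalBasis_inner_cross_eq o hn
  rw [← b.sum_sq_norm_inner_left, ← b.sum_sq_norm_inner_right u, real_inner_comm _ u]
  simp only [Fin.sum_univ_three, h, orthonormal_iff_ite.1 b.orthonormal, Real.norm_eq_abs, sq_abs,
    Fin.isValue, Fin.reduceEq, one_ne_zero, zero_ne_one, ↓reduceIte]
  linear_combination (inner ℝ (b 0) u ^ 2 + inner ℝ (b 1) u ^ 2) * hd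

theorem inner_cross_sq {u v : TangentSpace (𝓡 3) x} (hu : inner ℝ u n = 0)
    (hv : inner ℝ v n = 0) :
    inner ℝ (cross o u n) v ^ 2 = ‖u‖ ^ 2 * ‖v‖ ^ 2 - inner ℝ u v ^ 2 := by
  obtain ⟨b, rfl, d, hd, h⟩ := exists_orthonormalBasis_inner_cross_eq o hn
  rw [h, ← b.sum_sq_norm_inner_right u, ← b.sum_sq_norm_inner_right v,
    ← b.sum_inner_mul_inner u v]
  simp only [Fin.sum_univ_three, Real.norm_eq_abs, sq_abs, hu, real_inner_comm _ (b 2), hv,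
    real_inner_comm (b 0) u, real_inner_comm (b 1) u]
  linear_combination
    (inner ℝ (b 0) u * inner ℝ (b 1) v - inner ℝ (b 1) u * inner ℝ (b 0) v) ^ 2 * hd

theorem exists_eq_smul_cross_of_skew {S : TangentSpace (𝓡 3) x →L[ℝ] TangentSpace (𝓡 3) x}
    (hS : ∀ u w, inner ℝ (S u) w = -inner ℝ (S w) u) (hSn : S n = 0) :
    ∃ t : ℝ, ∀ u, S u = t • cross o u n := by
  obtain ⟨b, rfl, d, hd, h⟩ := exists_orthonormalBasis_inner_cross_eq o hn
  refine ⟨inner ℝ (S (b 0)) (b 1) * d, fun u ↦ ext_inner_right ℝ fun w ↦ ?_⟩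
  have inner_self (v) : inner ℝ (S v) v = 0 := self_eq_neg.1 (hS v v)
  have inner_normal (v) : inner ℝ (S v) (b 2) = 0 := by rw [hS, hSn, inner_zero_left, neg_zero]
  rw [real_inner_smul_left, h]
  conv_lhs => rw [← b.sum_repr' u, ← b.sum_repr' w]
  simp only [Fin.sum_univ_three, map_add, map_smul, hSn, inner_add_left, inner_add_right,
    real_inner_smul_left, real_inner_smul_right, inner_self, inner_normal, hS (b 1) (b 0),
    smul_zero, inner_zero_left]
  linear_combination -inner ℝ (S (b 0)) (b 1) * (inner ℝ (b 0) u * inner ℝ (b 1) w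
    - inner ℝ (b 1) u * inner ℝ (b 0) w) * hd

end CrossProduct

theorem ker_eq_span_singleton_of_finrank_eq {V W : Type*} [AddCommGroup V] [Module ℝ V]
    [FiniteDimensional ℝ V] [AddCommGroup W] [Module ℝ W] {D : V →ₗ[ℝ] W}
    (hD : Function.Surjective D) (hrank : Module.finrank ℝ V = Module.finrank ℝ W + 1) {n : V}
    (hn : n ≠ 0) (hDn : D n = 0) : LinearMap.ker D = ℝ ∙ n := by
  refine (Submodule.eq_of_le_of_finrank_le
    ((Submodule.span_singleton_le_iff_mem _ _).2 hDn) ?_).symm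
  have := D.finrank_range_add_finrank_ker
  rw [LinearMap.range_eq_top.2 hD, finrank_top] at this
  rw [finrank_span_singleton hn]
  omega

section UnitVerticalField

variable {E : Type*} [NormedAddCommGroup E] [NormedSpace ℝ E] [FiniteDimensional ℝ E]
  {H : Type*} [TopologicalSpace H] {I : ModelWithCorners ℝ E H}
  {M : Type*} [TopologicalSpace M] [ChartedSpace H M]
  [RiemannianBundle (fun x : M ↦ TangentSpace I x)]
  {E' : Type*} [NormedAddCommGroup E'] [NormedSpace ℝ E'] [FiniteDimensional ℝ E']
  {H' : Type*} [TopologicalSpace H'] {I' : ModelWithCorners ℝ E' H'}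
  {M' : Type*} [TopologicalSpace M'] [ChartedSpace H' M']
  [RiemannianBundle (fun x : M' ↦ TangentSpace I' x)]
  {g : M → M'} {q : M}

theorem inner_mfderiv_mfderiv_of_verticalPart_eq_zero {u : TangentSpace I q}
    (hu : verticalPart I I' g q u = 0) (v : TangentSpace I q) :
    inner ℝ (mfderiv I I' g q u) (mfderiv I I' g q v) = inner ℝ u v := by
  rw [← ContinuousLinearMap.adjoint_inner_left, ← sub_eq_zero.1 hu]

namespace IsCoisometric

variable (hg : IsCoisometric I I' g)
include hg

theorem verticalPart_eq_smul {n : TangentSpace I q} (hn : ‖n‖ = 1)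
    (hker : LinearMap.ker (mfderiv I I' g q).toLinearMap = ℝ ∙ n) (w : TangentSpace I q) :
    verticalPart I I' g q w = inner ℝ w n • n := by
  obtain ⟨c, hc⟩ := Submodule.mem_span_singleton.1 (hker.le (hg.mfderiv_verticalPart w))
  have hDn : mfderiv I I' g q n = 0 := hker.ge (Submodule.mem_span_singleton_self n)
  have coeff : c = inner ℝ w n := calc
    c = inner ℝ (verticalPart I I' g q w) n := by
      rw [← hc, real_inner_smul_left, real_inner_self_eq_norm_sq, hn, one_pow, mul_one]
    _ = inner ℝ w n := by
      rw [inner_verticalPart_left, verticalPart, hDn, map_zero, sub_zero]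
  rw [← hc, coeff]

theorem verticalPart_eq_zero {n : TangentSpace I q} (hn : ‖n‖ = 1)
    (hker : LinearMap.ker (mfderiv I I' g q).toLinearMap = ℝ ∙ n) {u : TangentSpace I q}
    (hu : inner ℝ u n = 0) : verticalPart I I' g q u = 0 := by
  rw [hg.verticalPart_eq_smul hn hker, hu, zero_smul]

variable [IsManifold I ∞ M] [IsContMDiffRiemannianBundle I ∞ E (fun x : M ↦ TangentSpace I x)]
  [IsManifold I' ∞ M'] [IsContMDiffRiemannianBundle I' ∞ E' (fun x : M' ↦ TangentSpace I' x)]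
  {ξ : Π x : M, TangentSpace I x} (hξ : MDiffAt (T% ξ) q)
include hξ

theorem inner_leviCivita_horizontalLift_vertical (hvert : ∀ x, mfderiv I I' g x (ξ x) = 0)
    {Y : Π b : M', TangentSpace I' b} (hY : CMDiffAt 2 (T% Y) (g q)) (z : TangentSpace I q) :
    inner ℝ (leviCivita I (horizontalLift I g Y) q z) (ξ q) =
      -inner ℝ (leviCivita I ξ q z) (horizontalLift I g Y q) := by
  have metric := leviCivita_metric_apply (hg.mdifferentiableAt_horizontalLift hY) hξ z
  simp only [inner_horizontalLift, hvert, inner_zero_right, mvfderiv_const, zero_apply] at metric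
  rw [← inner_horizontalLift, real_inner_comm _ (horizontalLift I g Y q)] at metric
  linarith

variable (hunit : ‖ξ q‖ = 1)
  (hker : ∀ x, LinearMap.ker (mfderiv I I' g x).toLinearMap = ℝ ∙ ξ x)
include hunit hker

theorem inner_curvatureField_horizontalLift_of_unit {X Y : Π b : M', TangentSpace I' b}
    (hX : CMDiffAt ∞ (T% X) (g q)) (hY : CMDiffAt ∞ (T% Y) (g q)) :
    inner ℝ (curvatureField I (horizontalLift I g X) (horizontalLift I g Y)
        (horizontalLift I g Y) q) (horizontalLift I g X q) =
      inner ℝ (curvatureField I' X Y Y (g q)) (X (g q)) -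
        3 * inner ℝ (leviCivita I ξ q (horizontalLift I g X q)) (horizontalLift I g Y q) ^ 2 := by
  have hvert (x : M) : mfderiv I I' g x (ξ x) = 0 :=
    (hker x).ge (Submodule.mem_span_singleton_self _)
  have hX2 : CMDiffAt 2 (T% X) (g q) := hX.of_le ENat.LEInfty.out
  have hY2 : CMDiffAt 2 (T% Y) (g q) := hY.of_le ENat.LEInfty.out
  have self := self_eq_neg.1 (hg.inner_leviCivita_horizontalLift_swap hX2 hX2 (hvert q))
  rw [hg.inner_curvatureField_horizontalLift hX hY hY hX]
  simp only [hg.verticalPart_eq_smul hunit (hker q), inner_smul_right, self,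
    hg.inner_leviCivita_horizontalLift_swap hX2 hY2 (hvert q),
    hg.inner_leviCivita_horizontalLift_vertical hξ hvert hY2]
  ring

theorem inner_curvature_of_horizontal {u v : TangentSpace I q} (hu : inner ℝ u (ξ q) = 0)
    (hv : inner ℝ v (ξ q) = 0) :
    inner ℝ (curvature I q u v v) u =
      inner ℝ (curvature I' (g q) (mfderiv I I' g q u) (mfderiv I I' g q v)
        (mfderiv I I' g q v)) (mfderiv I I' g q u) - 3 * inner ℝ (leviCivita I ξ q u) v ^ 2 := by
  have exists_lift {w : TangentSpace I q} (hw : inner ℝ w (ξ q) = 0) :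
      ∃ W : Π b : M', TangentSpace I' b, CMDiffAt ∞ (T% W) (g q) ∧
        W (g q) = mfderiv I I' g q w ∧ horizontalLift I g W q = w := by
    refine ⟨extend E' _, contMDiffAt_extend I' E' _, extend_apply_self E' _, ?_⟩
    simpa only [hg.verticalPart_eq_zero hunit (hker q) hw, add_zero] using
      horizontalLift_add_verticalPart (extend_apply_self E' (mfderiv I I' g q w)).symm
  obtain ⟨X, hX, hXq, hXu⟩ := exists_lift hu
  obtain ⟨Y, hY, hYq, hYv⟩ := exists_lift hv
  have hXl := contMDiffAt_horizontalLift (n := ⊤) hg.smooth.contMDiffAt hX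
  have hYl := contMDiffAt_horizontalLift (n := ⊤) hg.smooth.contMDiffAt hY
  rw [← hXq, ← hYq, ← curvatureField_eq_curvature hX hY hY, ← hXu, ← hYv,
    ← curvatureField_eq_curvature hXl hYl hYl]
  exact hg.inner_curvatureField_horizontalLift_of_unit hξ hunit hker hX hY

theorem sectionalCurvature_of_horizontal {u v : TangentSpace I q} (hu : inner ℝ u (ξ q) = 0)
    (hv : inner ℝ v (ξ q) = 0) :
    sectionalCurvature I q u v =
      sectionalCurvature I' (g q) (mfderiv I I' g q u) (mfderiv I I' g q v) -
        3 * inner ℝ (leviCivita I ξ q u) v ^ 2 / (‖u‖ ^ 2 * ‖v‖ ^ 2 - inner ℝ u v ^ 2) := by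
  have hu' := hg.verticalPart_eq_zero hunit (hker q) hu
  have hv' := hg.verticalPart_eq_zero hunit (hker q) hv
  rw [sectionalCurvature, sectionalCurvature, hg.inner_curvature_of_horizontal hξ hunit hker hu hv,
    sub_div]
  simp only [← real_inner_self_eq_norm_sq, inner_mfderiv_mfderiv_of_verticalPart_eq_zero hu',
    inner_mfderiv_mfderiv_of_verticalPart_eq_zero hv']

end IsCoisometric

end UnitVerticalField

theorem mfderiv_eq_zero_of_constant_on_trajectory {E : Type*} [NormedAddCommGroup E]
    [NormedSpace ℝ E] {H : Type*} [TopologicalSpace H] {I : ModelWithCorners ℝ E H}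
    {M : Type*} [TopologicalSpace M] [ChartedSpace H M] {E' : Type*} [NormedAddCommGroup E']
    [NormedSpace ℝ E'] {H' : Type*} [TopologicalSpace H'] {I' : ModelWithCorners ℝ E' H'}
    {M' : Type*} [TopologicalSpace M'] [ChartedSpace H' M'] {g : M → M'} {q : M}
    {ξ : Π x : M, TangentSpace I x} (hg : MDifferentiableAt I I' g q)
    (hq : q ∈ trajectory I ξ q) (hconst : ∀ y ∈ trajectory I ξ q, g y = g q) :
    mfderiv I I' g q (ξ q) = 0 := by
  obtain ⟨γ, s, hs, hs', h0, hγ, rfl, -⟩ := hq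
  have comp_const : g ∘ γ =ᶠ[𝓝 0] fun _ ↦ g (γ 0) :=
    Filter.eventuallyEq_of_mem (hs.mem_nhds h0) fun t ht ↦
      hconst _ ⟨γ, s, hs, hs', h0, hγ, rfl, t, ht, rfl⟩
  have chain := hg.hasMFDerivAt.comp 0 ((hγ 0 h0).hasMFDerivAt (hs.mem_nhds h0))
  have zero := (hasMFDerivAt_const (I := 𝓘(ℝ, ℝ)) (I' := I') (g (γ 0))
    (0 : ℝ)).congr_of_eventuallyEq comp_const
  have := congr($(hasMFDerivAt_unique chain zero) (1 : ℝ))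
  change mfderiv I I' g (γ 0) ((1 : ℝ) • ξ (γ 0)) = 0 at this
  rwa [one_smul] at this

section BundleCurvature

variable {M : Type*} [TopologicalSpace M] [ChartedSpace (EuclideanSpace ℝ (Fin 3)) M]
  [IsManifold (𝓡 3) ∞ M] [RiemannianBundle (fun x : M ↦ TangentSpace (𝓡 3) x)]
  [IsContMDiffRiemannianBundle (𝓡 3) ∞ (EuclideanSpace ℝ (Fin 3))
    (fun x : M ↦ TangentSpace (𝓡 3) x)]
  {o : ManifoldOrientation M} {ξ : Π x : M, TangentSpace (𝓡 3) x}
  (hξ : IsKilling (𝓡 3) ξ) (hunit : ∀ x, ‖ξ x‖ = 1)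
include hξ hunit

theorem exists_isBundleCurvature (o : ManifoldOrientation M) :
    ∃ τ : M → ℝ, IsBundleCurvature o ξ τ := by
  choose τ hτ using fun p ↦ exists_eq_smul_cross_of_skew o (hunit p)
    (hξ.inner_leviCivita_skew p) (hξ.leviCivita_self hunit p)
  exact ⟨τ, hτ⟩

theorem sectionalCurvature_killing {τ : M → ℝ} (hτ : IsBundleCurvature o ξ τ) {p : M}
    {u : TangentSpace (𝓡 3) p} (hu : LinearIndependent ℝ ![u, ξ p]) :
    sectionalCurvature (𝓡 3) p u (ξ p) = τ p ^ 2 := by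
  have gram_ne_zero := gram_ne_zero_iff_linearIndependent.2 hu
  rw [hunit, one_pow, mul_one] at gram_ne_zero
  rw [hξ.sectionalCurvature_self hunit, hτ, norm_smul, mul_pow, norm_sq_cross o (hunit p),
    Real.norm_eq_abs, sq_abs, mul_div_cancel_right₀ _ gram_ne_zero]

end BundleCurvature

section KillingSubmersion

variable {M : Type*} [TopologicalSpace M] [ChartedSpace (EuclideanSpace ℝ (Fin 3)) M]
  [RiemannianBundle (fun x : M ↦ TangentSpace (𝓡 3) x)]
  {B : Type*} [TopologicalSpace B] [ChartedSpace (EuclideanSpace ℝ (Fin 2)) B]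
  {pr : M → B} {ξ : Π x : M, TangentSpace (𝓡 3) x}

theorem isHorizontal_iff {p : M}
    (hker : LinearMap.ker (mfderiv (𝓡 3) (𝓡 2) pr p).toLinearMap = ℝ ∙ ξ p)
    {u : TangentSpace (𝓡 3) p} : IsHorizontal pr p u ↔ inner ℝ u (ξ p) = 0 := by
  rw [← Submodule.mem_orthogonal_singleton_iff_inner_left, ← hker, Submodule.mem_orthogonal']
  rfl

variable [RiemannianBundle (fun b : B ↦ TangentSpace (𝓡 2) b)]

theorem IsRiemannianSubmersion.isCoisometric (h : IsRiemannianSubmersion pr) :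
    IsCoisometric (𝓡 3) (𝓡 2) pr where
  smooth := h.smooth
  mfderiv_comp_adjoint p := comp_adjoint_eq_id (h.mfderiv_surjective p) fun u hu ↦
    h.norm_mfderiv p u ((Submodule.mem_orthogonal' _ _).1 hu)

theorem IsCoisometric.ker_mfderiv (hpr : IsCoisometric (𝓡 3) (𝓡 2) pr) {p : M}
    {n : TangentSpace (𝓡 3) p} (hn : ‖n‖ = 1) (hDn : mfderiv (𝓡 3) (𝓡 2) pr p n = 0) :
    LinearMap.ker (mfderiv (𝓡 3) (𝓡 2) pr p).toLinearMap = ℝ ∙ n := by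
  refine ker_eq_span_singleton_of_finrank_eq (fun w ↦ ⟨_, hpr.mfderiv_adjoint w⟩) ?_
    (norm_ne_zero_iff.1 (hn ▸ one_ne_zero)) hDn
  exact (finrank_euclideanSpace_fin (𝕜 := ℝ) (n := 3)).trans
    congr($(finrank_euclideanSpace_fin (𝕜 := ℝ) (n := 2)) + 1).symm

variable [IsManifold (𝓡 3) ∞ M]

theorem IsKillingSubmersion.mfderiv_killing (h : IsKillingSubmersion pr ξ) (p : M) :
    mfderiv (𝓡 3) (𝓡 2) pr p (ξ p) = 0 :=
  mfderiv_eq_zero_of_constant_on_trajectory (h.submersion.smooth.mdifferentiableAt (by simp))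
    ((h.fiber_eq p).le rfl) fun _ hy ↦ (h.fiber_eq p).ge hy

variable [IsContMDiffRiemannianBundle (𝓡 3) ∞ (EuclideanSpace ℝ (Fin 3))
    (fun x : M ↦ TangentSpace (𝓡 3) x)]
  [IsManifold (𝓡 2) ∞ B] [IsContMDiffRiemannianBundle (𝓡 2) ∞ (EuclideanSpace ℝ (Fin 2))
    (fun b : B ↦ TangentSpace (𝓡 2) b)]

theorem sectionalCurvature_of_isHorizontal {o : ManifoldOrientation M}
    (hpr : IsCoisometric (𝓡 3) (𝓡 2) pr) {p : M}
    (hξ : MDifferentiableAt (𝓡 3) (𝓡 3).tangent (T% ξ) p) (hunit : ∀ x, ‖ξ x‖ = 1)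
    (hvert : ∀ x, mfderiv (𝓡 3) (𝓡 2) pr x (ξ x) = 0) {τ : M → ℝ}
    (hτ : IsBundleCurvature o ξ τ) {u v : TangentSpace (𝓡 3) p} (hu : IsHorizontal pr p u)
    (hv : IsHorizontal pr p v) (huv : LinearIndependent ℝ ![u, v]) :
    sectionalCurvature (𝓡 3) p u v = gaussCurvature (pr p) - 3 * τ p ^ 2 := by
  have hker (x : M) := hpr.ker_mfderiv (hunit x) (hvert x)
  rw [isHorizontal_iff (hker p)] at hu hv
  have hu' := hpr.verticalPart_eq_zero (hunit p) (hker p) hu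
  have hv' := hpr.verticalPart_eq_zero (hunit p) (hker p) hv
  have images_independent : LinearIndependent ℝ
      ![mfderiv (𝓡 3) (𝓡 2) pr p u, mfderiv (𝓡 3) (𝓡 2) pr p v] := by
    rw [← gram_ne_zero_iff_linearIndependent] at huv ⊢
    simpa only [← real_inner_self_eq_norm_sq, inner_mfderiv_mfderiv_of_verticalPart_eq_zero hu',
      inner_mfderiv_mfderiv_of_verticalPart_eq_zero hv'] using huv
  rw [hpr.sectionalCurvature_of_horizontal hξ (hunit p) hker hu hv,
    gaussCurvature_eq_sectionalCurvature images_independent, hτ, real_inner_smul_left, mul_pow,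
    inner_cross_sq o (hunit p) hu hv, ← mul_assoc,
    mul_div_cancel_right₀ _ (gram_ne_zero_iff_linearIndependent.2 huv)]

end KillingSubmersion

end KillingSubmersion

end

open KillingSubmersion in
theorem lemma2p8_general
    {M : Type*} [TopologicalSpace M] [ChartedSpace (EuclideanSpace ℝ (Fin 3)) M]
    [IsManifold (𝓡 3) ∞ M] [RiemannianBundle (fun x : M ↦ TangentSpace (𝓡 3) x)]
    [IsContMDiffRiemannianBundle (𝓡 3) ∞ (EuclideanSpace ℝ (Fin 3))
      (fun x : M ↦ TangentSpace (𝓡 3) x)]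
    {B : Type*} [TopologicalSpace B] [ChartedSpace (EuclideanSpace ℝ (Fin 2)) B]
    [IsManifold (𝓡 2) ∞ B] [RiemannianBundle (fun b : B ↦ TangentSpace (𝓡 2) b)]
    [IsContMDiffRiemannianBundle (𝓡 2) ∞ (EuclideanSpace ℝ (Fin 2))
      (fun b : B ↦ TangentSpace (𝓡 2) b)]
    (o : ManifoldOrientation M) {pr : M → B} {ξ : Π x : M, TangentSpace (𝓡 3) x}
    (hpr : IsCoisometric (𝓡 3) (𝓡 2) pr) (hξ : IsKilling (𝓡 3) ξ) (hunit : ∀ p, ‖ξ p‖ = 1)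
    (hvert : ∀ p, mfderiv (𝓡 3) (𝓡 2) pr p (ξ p) = 0) :
    (∃ τ : M → ℝ, IsBundleCurvature o ξ τ) ∧
    ∀ τ : M → ℝ, IsBundleCurvature o ξ τ → ∀ p : M,
      (∀ u v : TangentSpace (𝓡 3) p, IsHorizontal pr p u → IsHorizontal pr p v →
        LinearIndependent ℝ ![u, v] →
        sectionalCurvature (𝓡 3) p u v = gaussCurvature (pr p) - 3 * τ p ^ 2) ∧
      (∀ u : TangentSpace (𝓡 3) p, LinearIndependent ℝ ![u, ξ p] →
        sectionalCurvature (𝓡 3) p u (ξ p) = τ p ^ 2) :=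
  ⟨exists_isBundleCurvature hξ hunit o, fun _ hτ p ↦
    ⟨fun _ _ ↦ sectionalCurvature_of_isHorizontal hpr (hξ.mdifferentiableAt p) hunit hvert hτ,
      fun _ ↦ sectionalCurvature_killing hξ hunit hτ⟩⟩

open KillingSubmersion in
theorem lemma2p8
    {M : Type*} [TopologicalSpace M] [T2Space M] [ChartedSpace (EuclideanSpace ℝ (Fin 3)) M]
    [IsManifold (𝓡 3) ∞ M] [RiemannianBundle (fun x : M ↦ TangentSpace (𝓡 3) x)]
    [IsContMDiffRiemannianBundle (𝓡 3) ∞ (EuclideanSpace ℝ (Fin 3))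
      (fun x : M ↦ TangentSpace (𝓡 3) x)]
    {B : Type*} [TopologicalSpace B] [T2Space B] [ChartedSpace (EuclideanSpace ℝ (Fin 2)) B]
    [IsManifold (𝓡 2) ∞ B] [RiemannianBundle (fun b : B ↦ TangentSpace (𝓡 2) b)]
    [IsContMDiffRiemannianBundle (𝓡 2) ∞ (EuclideanSpace ℝ (Fin 2))
      (fun b : B ↦ TangentSpace (𝓡 2) b)]
    (o : ManifoldOrientation M) (pr : M → B) (ξ : Π x : M, TangentSpace (𝓡 3) x)
    (h : IsKillingSubmersion pr ξ) :
    (∃ τ : M → ℝ, IsBundleCurvature o ξ τ) ∧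
    ∀ τ : M → ℝ, IsBundleCurvature o ξ τ → ∀ p : M,
      (∀ u v : TangentSpace (𝓡 3) p, IsHorizontal pr p u → IsHorizontal pr p v →
        LinearIndependent ℝ ![u, v] →
        sectionalCurvature (𝓡 3) p u v = gaussCurvature (pr p) - 3 * τ p ^ 2) ∧
      (∀ u : TangentSpace (𝓡 3) p, LinearIndependent ℝ ![u, ξ p] →
        sectionalCurvature (𝓡 3) p u (ξ p) = τ p ^ 2) :=
  lemma2p8_general o h.submersion.isCoisometric h.killing h.unit h.mfderiv_killing
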